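/- **Parity games.** A parity game with $c$ priorities consists of a finite non-empty set $V$ of $n$ vertices, a set $E\subseteq V\times V$ of edges such that every vertex has at least one outgoing edge, a partition $V=V_{\mathcal E}\cup V_{\mathcal O}$ into the vertices of the players $\mathcal E$ and $\mathcal O$, and a priority function $\alpha:V\to[c]=\{0,\dots,c-1\}$. Let $P_i=\{v:\alpha(v)=i\}$; it is assumed that $P_i\neq\emptyset$ for $0<i<c$. A (memoryless) strategy of a player chooses an outgoing edge at each of the player's vertices; a strategy of each player and a start vertex determine an infinite play. Player $\mathcal E$ (resp. $\mathcal O$) wins a play iff the highest priority that occurs infinitely often in it is even (resp. odd). The winning set $W_z$ of player $z$ is the set of the vertices $v$ such that $z$ has a strategy that wins the play from $v$ against every strategy of the opponent. **Set-based symbolic algorithms.** Such an algorithm accesses the game only through stored sets of vertices (initially $V,P_0,\dots,P_{c-1}$) and the numbers $c,|P_0|,\dots,|P_{c-1}|$. It may apply to its sets the basic set operations $\cup,\cap,\setminus,\subseteq,=$ and the one-step operations $\mathrm{Pre}(B)=\{v\mid \exists u\in B:(v,u)\in E\}$ and $\mathrm{CPre}_z(B)=\{v\in V_z\mid \mathrm{Out}(v)\cap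 B\ne\emptyset\}\cup\{v\notin V_z\mid \mathrm{Out}(v)\subseteq B\}$, where $\mathrm{Out}(v)$ is the set of successors of $v$. Executions of the two kinds of operations are counted separately; computations that involve no sets of vertices are free. Its space is the number of sets that it stores (including the input sets). **Ranks.** Let $n_i=|P_i|$ for odd $i$ and $n_i=0$ for even $i$, let $M_G=\prod_{i=0}^{c-1}\{0,\dots,n_i\}$, ordered lexicographically with the last entry the most significant one, and $M_G^\infty=M_G\cup\{\top\}$ with $\top$ the maximum. Let $\bar 0$ be the zero vector, $\mathrm{incr}$ and $\mathrm{decr}$ the successor and predecessor in $M^\infty_G$ (with $\mathrm{incr}(\top)=\top$, $\mathrm{decr}(\bar 0)=\bar 0$). Let $\langle x\rangle_\ell$ arise from $x$ by setting the entries with index $<\ell$ to $0$, with $\langle\top\rangle_\ell=\top$. Let $\mathrm{incr}_\ell(\top)=\top$ and, for $x\neq\top$, $\mathrm{incr}_\ell(x)=\langle x\rangle_\ell$ if $\ell$ is even and $\mathrm{incr}_\ell(x)=\min\{y\in M_G^\infty\mid \langle y\rangle_\ell>\langle x\rangle_\ell\}$ if $\ell$ is odd. Let $\mathrm{decr}_\ell(x)=\bar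 0$ if $\langle x\rangle_\ell=\bar 0$, and $\mathrm{decr}_\ell(x)=\min\{y\in M_G\mid x=\mathrm{incr}_\ell(y)\}$ otherwise. **The algorithm** (SymbolicParityDominion with codomain $M_G^\infty$ and succinct sets). For each odd $i<c$ and $0\le x\le n_i$ it stores a set $C^i_x$ (the vertices whose rank is a vector with $i$-th entry $x$), and it stores a set $S_\top$ (the vertices of rank $\top$). These sets represent $S_q$, the set of the vertices of rank at least $q$, for every $q\in M_G^\infty$. For $q\neq\top$ the set $S_q$ is reconstructed as $$S_q=S_\top\cup\bigcap_{i}C^i_{q_i}\cup\bigcup_{i}\Big(\bigcap_{j>i}C^j_{q_j}\cap\bigcup_{q_i<x\le n_i}C^i_x\Big)$$ ($i,j$ odd, empty intersections being $V$), going once through the odd priorities from the highest one downwards and keeping the intersection obtained so far. Initially $C^i_0=V$, $C^i_x=\emptyset$ for $x>0$, $S_\top=\emptyset$, $r=\mathrm{incr}(\bar 0)$. Then repeat the following. 1. Reconstruct $S_r$, and let $S:=S_r$. If $r\neq\top$, let $\ell$ be maximal with $r=\langle r\rangle_\ell$; for every odd $i\le\ell$ let $S:=S\cup(\mathrm{CPre}_{\mathcal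 O}(S_{\mathrm{decr}_i(r)})\cap P_i)$; then repeat $S:=S\cup(\mathrm{CPre}_{\mathcal O}(S)\setminus\bigcup_{\ell<k<c}P_k)$ until $S$ does not change. If $r=\top$, do the same with all odd $i<c$ and with no $P_k$ removed. 2. Let $r'=\mathrm{decr}(r)$. If $S\subseteq S_{r'}$, the next rank is $\mathrm{incr}(r)$ if $r<\top$, and the loop ends after step 3 if $r=\top$. If $S\not\subseteq S_{r'}$, replace $r'$ by $\mathrm{decr}(r')$, at least once, until $S\subseteq S_{r'}$; the next rank is $\mathrm{incr}(r')$. 3. Store the result: with $D=S\setminus S_r$, replace every $C^i_x$ by $C^i_x\setminus D$; then, if $r=\top$, replace $S_\top$ by $S_\top\cup D$, and otherwise replace $C^i_{r_i}$ by $C^i_{r_i}\cup D$ for every odd $i$. Continue with the next rank. At the end return $V\setminus S_\top$. **Theorem.** Let $\xi(n,c)=\big(\frac{n}{\lfloor c/2\rfloor}\big)^{\lfloor c/2\rfloor}$ (with $\xi(n,1)=1$). There is an absolute constant $K$ such that for every parity game as above, with $n$ vertices and $c$ priorities, the algorithm terminates and computes the winning sets: it returns $W_{\mathcal E}$, and $S_\top=W_{\mathcal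 O}$ at termination. It executes at most $K\cdot c\cdot n\cdot\xi(n,c)$ one-step operations and at most $K\cdot c\cdot n^2\cdot\xi(n,c)$ basic set operations, and it stores at most $K\cdot n$ sets. -/

import Mathlib

namespace SymbolicParity

/-! ## Parity games -/

/-- The two players, `even` (player `E`) and `odd` (player `O`). -/
inductive Player
  | even
  | odd

/-- A parity game on the vertex set `V` with priorities in `[c] = {0, …, c - 1}`. Every vertex has
at least one outgoing edge. -/
structure ParityGame (V : Type*) (c : ℕ) where
  Edge : V → V → Prop
  owner : V → Player
  prio : V → Fin c
  exists_edge : ∀ v, ∃ w, Edge v w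

namespace ParityGame

variable {V : Type*} {c : ℕ}

/-- The set `P_i` of the vertices of priority `i`. -/
def prioSet (G : ParityGame V c) (i : Fin c) : Set V := {v | G.prio v = i}

/-- The numbers `|P_i|`. -/
noncomputable def classSize (G : ParityGame V c) (i : Fin c) : ℕ := (G.prioSet i).ncard

/-- A memoryless strategy of player `z`: a choice of an outgoing edge at each vertex of `z`.
The values of `move` at the other vertices are never used. -/
structure Strategy (G : ParityGame V c) (z : Player) where
  move : V → V
  edge_move : ∀ v, G.owner v = z → G.Edge v (move v)

/-- The play from `v` that is determined by a strategy of each of the two players. -/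
def play (G : ParityGame V c) (σ : G.Strategy .even) (τ : G.Strategy .odd) (v : V) : ℕ → V
  | 0 => v
  | t + 1 =>
    match G.owner (G.play σ τ v t) with
    | .even => σ.move (G.play σ τ v t)
    | .odd => τ.move (G.play σ τ v t)

/-- The priorities that occur infinitely often in an infinite sequence of vertices. -/
def infinitelyOften (G : ParityGame V c) (p : ℕ → V) : Set (Fin c) :=
  {i | ∃ᶠ t in Filter.atTop, G.prio (p t) = i}

/-- Player `even` wins `p`: the highest priority occurring infinitely often is even. -/
def EvenWins (G : ParityGame V c) (p : ℕ → V) : Prop :=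
  ∃ i : Fin c, IsGreatest (G.infinitelyOften p) i ∧ Even i.val

/-- Player `odd` wins `p`: the highest priority occurring infinitely often is odd. -/
def OddWins (G : ParityGame V c) (p : ℕ → V) : Prop :=
  ∃ i : Fin c, IsGreatest (G.infinitelyOften p) i ∧ Odd i.val

/-- The winning set of player `even`. -/
def winEven (G : ParityGame V c) : Set V :=
  {v | ∃ σ : G.Strategy .even, ∀ τ : G.Strategy .odd, G.EvenWins (G.play σ τ v)}

/-- The winning set of player `odd`. -/
def winOdd (G : ParityGame V c) : Set V :=
  {v | ∃ τ : G.Strategy .odd, ∀ σ : G.Strategy .even, G.OddWins (G.play σ τ v)}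

/-- The one-step predecessor operator. -/
def pre (G : ParityGame V c) (B : Set V) : Set V := {v | ∃ u ∈ B, G.Edge v u}

/-- The one-step controllable predecessor operator of player `z`. -/
def cpre (G : ParityGame V c) (z : Player) (B : Set V) : Set V :=
  {v | G.owner v = z ∧ ∃ u, G.Edge v u ∧ u ∈ B} ∪
    {v | G.owner v ≠ z ∧ ∀ u, G.Edge v u → u ∈ B}

end ParityGame

/-! ## Set-based symbolic programs

A program works on a collection `ρ` of registers, each of which holds a set of vertices, and on
data of a type `σ`. The number of registers is the number of sets that it stores. Its text does not
mention the game; the sets can be accessed only through the basic set operations and the one-step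
operations below, whose executions are counted. Computations on the data are not counted. -/

/-- Basic set operations with a set as result. -/
inductive SetOp
  | union
  | inter
  | diff

/-- One-step operations. -/
inductive StepOp
  | pre
  | cpre (z : Player)

/-- Conditions: on the data, or a comparison of two registers. -/
inductive Cond (σ ρ : Type)
  | data (b : σ → Prop)
  | subset (a b : ρ)
  | eq (a b : ρ)
  | not (q : Cond σ ρ)

/-- Set-based symbolic programs. `withData f` runs the program `f d`, where `d` is the current
value of the data. -/
inductive Prog (σ ρ : Type)
  | skip
  | setOp (o : SetOp) (dst a b : ρ)
  | stepOp (o : StepOp) (dst a : ρ)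
  | modify (f : σ → σ)
  | withData (f : σ → Prog σ ρ)
  | seq (p q : Prog σ ρ)
  | ite (b : Cond σ ρ) (p q : Prog σ ρ)
  | while (b : Cond σ ρ) (p : Prog σ ρ)

/-- A state of a program: the data and the contents of the registers. -/
structure State (V : Type*) (σ ρ : Type) where
  data : σ
  reg : ρ → Set V

section Semantics

variable {V : Type*} {c : ℕ} {σ ρ : Type}

open Classical in
/-- Store the set `B` in the register `dst`. -/
noncomputable def State.store (s : State V σ ρ) (dst : ρ) (B : Set V) : State V σ ρ :=
  ⟨s.data, Function.update s.reg dst B⟩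

def SetOp.eval : SetOp → Set V → Set V → Set V
  | .union, A, B => A ∪ B
  | .inter, A, B => A ∩ B
  | .diff, A, B => A \ B

def StepOp.eval (G : ParityGame V c) : StepOp → Set V → Set V
  | .pre, B => G.pre B
  | .cpre z, B => G.cpre z B

def Cond.holds (s : State V σ ρ) : Cond σ ρ → Prop
  | .data b => b s.data
  | .subset a b => s.reg a ⊆ s.reg b
  | .eq a b => s.reg a = s.reg b
  | .not q => ¬ q.holds s

/-- The number of basic set operations needed to evaluate a condition. -/
def Cond.cost : Cond σ ρ → ℕ
  | .data _ => 0
  | .subset _ _ => 1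
  | .eq _ _ => 1
  | .not q => q.cost

/-- `Exec G p s s' a b`: on the game `G`, the program `p` started in the state `s` terminates in the
state `s'`, after executing `a` basic set operations and `b` one-step operations. -/
inductive Exec (G : ParityGame V c) :
    Prog σ ρ → State V σ ρ → State V σ ρ → ℕ → ℕ → Prop
  | skip (s : State V σ ρ) : Exec G .skip s s 0 0
  | setOp (o : SetOp) (dst a b : ρ) (s : State V σ ρ) :
      Exec G (.setOp o dst a b) s (s.store dst (o.eval (s.reg a) (s.reg b))) 1 0
  | stepOp (o : StepOp) (dst a : ρ) (s : State V σ ρ) :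
      Exec G (.stepOp o dst a) s (s.store dst (o.eval G (s.reg a))) 0 1
  | modify (f : σ → σ) (s : State V σ ρ) :
      Exec G (.modify f) s ⟨f s.data, s.reg⟩ 0 0
  | withData (f : σ → Prog σ ρ) (s s' : State V σ ρ) (a b : ℕ) :
      Exec G (f s.data) s s' a b → Exec G (.withData f) s s' a b
  | seq (p q : Prog σ ρ) (s s' s'' : State V σ ρ) (a b a' b' : ℕ) :
      Exec G p s s' a b → Exec G q s' s'' a' b' → Exec G (.seq p q) s s'' (a + a') (b + b')
  | iteTrue (t : Cond σ ρ) (p q : Prog σ ρ) (s s' : State V σ ρ) (a b : ℕ) :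
      t.holds s → Exec G p s s' a b → Exec G (.ite t p q) s s' (t.cost + a) b
  | iteFalse (t : Cond σ ρ) (p q : Prog σ ρ) (s s' : State V σ ρ) (a b : ℕ) :
      ¬ t.holds s → Exec G q s s' a b → Exec G (.ite t p q) s s' (t.cost + a) b
  | whileTrue (t : Cond σ ρ) (p : Prog σ ρ) (s s' s'' : State V σ ρ) (a b a' b' : ℕ) :
      t.holds s → Exec G p s s' a b → Exec G (.while t p) s' s'' a' b' →
      Exec G (.while t p) s s'' (t.cost + a + a') (b + b')
  | whileFalse (t : Cond σ ρ) (p : Prog σ ρ) (s : State V σ ρ) :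
      ¬ t.holds s → Exec G (.while t p) s s t.cost 0

end Semantics

namespace Prog

variable {σ ρ : Type}

/-- Run the programs of a list one after the other. -/
def block : List (Prog σ ρ) → Prog σ ρ
  | [] => .skip
  | p :: ps => .seq p (block ps)

/-- `for i in l do p i`. -/
def forEach {ι : Type} (l : List ι) (p : ι → Prog σ ρ) : Prog σ ρ := block (l.map p)

/-- `repeat p until t`. -/
def repeatUntil (p : Prog σ ρ) (t : Cond σ ρ) : Prog σ ρ := .seq p (.while (.not t) p)

/-- `dst ← a`. -/
def copy (dst a : ρ) : Prog σ ρ := .setOp .union dst a a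

end Prog

/-! ## Ranks

In this section `m i` is the number of vertices of priority `i`. -/

section Ranks

variable {c : ℕ} (m : Fin c → ℕ)

/-- The numbers `n_i`: `n_i = m i` for odd `i` and `n_i = 0` for even `i`. -/
def coordMax (i : Fin c) : ℕ := if Odd i.val then m i else 0

/-- The set `M_G` of the vectors `(x_0, …, x_{c-1})` with `0 ≤ x_i ≤ n_i`, in the lexicographic
order in which the last entry is the most significant one. -/
abbrev RankVec : Type := Colex ((i : Fin c) → Fin (coordMax m i + 1))

/-- The set `M_G^∞ = M_G ∪ {⊤}`. -/
abbrev Rank : Type := WithTop (RankVec m)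

/-- The vector `0̄`. -/
def zeroVec : RankVec m := toColex fun _ => 0

/-- The rank `0̄`. -/
def zeroRank : Rank m := (zeroVec m : RankVec m)

variable {m}

open Classical in
/-- The least rank with property `p`, and `⊤` if there is none. -/
noncomputable def leastRank (p : Rank m → Prop) : Rank m :=
  if h : ∃ y, IsLeast {y | p y} y then h.choose else ⊤

open Classical in
/-- The greatest rank with property `p`, and `0̄` if there is none. -/
noncomputable def greatestRank (p : Rank m → Prop) : Rank m :=
  if h : ∃ y, IsGreatest {y | p y} y then h.choose else zeroRank m

/-- The successor in the order of the ranks, with `incr ⊤ = ⊤`. -/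
noncomputable def incr (r : Rank m) : Rank m := leastRank fun y => r < y

/-- The predecessor in the order of the ranks, with `decr 0̄ = 0̄`. -/
noncomputable def decr (r : Rank m) : Rank m := greatestRank fun y => y < r

/-- Set all entries with index less than `l` to `0`. -/
def projVec (l : ℕ) (x : RankVec m) : RankVec m :=
  toColex fun i => if i.val < l then 0 else ofColex x i

/-- Set all entries with index less than `l` to `0`; `⊤` is left unchanged. -/
def proj (l : ℕ) (x : Rank m) : Rank m := x.map (projVec l)

open Classical in
/-- `incr_l`, for a priority `l`. -/
noncomputable def incrAt (l : ℕ) (x : Rank m) : Rank m :=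
  if x = ⊤ then ⊤
  else if Even l then proj l x
  else leastRank fun y => proj l x < proj l y

open Classical in
/-- `decr_l`, for a priority `l`. -/
noncomputable def decrAt (l : ℕ) (x : Rank m) : Rank m :=
  if proj l x = zeroRank m then zeroRank m
  else leastRank fun y => y ≠ ⊤ ∧ x = incrAt l y

open Classical in
/-- The maximal `l < c` with `r = proj l r`. -/
noncomputable def level (r : Rank m) : ℕ := Nat.findGreatest (fun l => r = proj l r) (c - 1)

end Ranks

/-- The odd priority `2 k - 1`, `1 ≤ k ≤ ⌊c / 2⌋`; here `k` is counted from `0`. -/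
def oddPrio {c : ℕ} (k : Fin (c / 2)) : Fin c := ⟨2 * k.val + 1, by omega⟩

/-! ## The algorithm -/

/-- The sets that the algorithm stores. -/
inductive Reg {c : ℕ} (m : Fin c → ℕ) : Type
  /-- input: the set of all vertices -/
  | all
  /-- input: the set `P_i` of the vertices of priority `i` -/
  | prio (i : Fin c)
  /-- the set `C^i_x`, where `i` is the odd priority `oddPrio k` -/
  | coord (k : Fin (c / 2)) (x : Fin (coordMax m (oddPrio k) + 1))
  /-- the set `S_⊤` -/
  | top
  /-- the set `S_r` for the current rank `r`, as it was at the beginning of the iteration -/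
  | old
  /-- the updated set `S_r` -/
  | new
  /-- the previous value of `new` in the fixed-point computation -/
  | prev
  /-- the union of the priority classes that are excluded in the fixed-point computation -/
  | excluded
  /-- auxiliary sets -/
  | work
  | acc
  | aux
  /-- the output -/
  | result
deriving Fintype

/-- The data of the algorithm: the ranks `r` and `r'`, and whether the main loop has been left. -/
structure Data {c : ℕ} (m : Fin c → ℕ) : Type where
  r : Rank m
  r' : Rank m
  done : Bool

section Algorithm

variable {c : ℕ} (m : Fin c → ℕ)

/-- `dst ← ∅`. -/
def clear (dst : Reg m) : Prog (Data m) (Reg m) := .setOp .diff dst .all .all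

/-- Initially all vertices have rank `0̄`. -/
def initialise : Prog (Data m) (Reg m) :=
  .block [
    clear m .top,
    .forEach (List.finRange (c / 2)) fun k =>
      .forEach (List.finRange (coordMax m (oddPrio k) + 1)) fun x =>
        if x = 0 then .copy (.coord k x) .all else clear m (.coord k x)]

/-- `dst ← S_q`, where the set `S_q` of the vertices of rank at least `q` is computed from the
stored sets `C^i_x` and `S_⊤`. The odd priorities are treated from the highest one downwards;
`acc` is the set of the vertices whose rank agrees with `q` in the entries treated so far. -/
noncomputable def reconstruct (q : Rank m) (dst : Reg m) : Prog (Data m) (Reg m) :=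
  match q with
  | none => .copy dst .top
  | some q =>
    .block [
      .copy dst .top,
      .copy .acc .all,
      .forEach (List.finRange (c / 2)).reverse fun k =>
        .block [
          clear m .aux,
          .forEach ((List.finRange (coordMax m (oddPrio k) + 1)).filter
              fun x => ofColex q (oddPrio k) < x) fun x =>
            .setOp .union .aux .aux (.coord k x),
          .setOp .inter .aux .acc .aux,
          .setOp .union dst dst .aux,
          .setOp .inter .acc .acc (.coord k (ofColex q (oddPrio k)))],
      .setOp .union dst dst .acc]

/-- `new ← new ∪ (CPre_O(S_{decr_i(r)}) ∩ P_i)`, where `i` is the odd priority `oddPrio k`. -/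
noncomputable def addOdd (r : Rank m) (k : Fin (c / 2)) : Prog (Data m) (Reg m) :=
  .block [
    reconstruct m (decrAt (oddPrio k).val r) .work,
    .stepOp (.cpre .odd) .work .work,
    .setOp .inter .work .work (.prio (oddPrio k)),
    .setOp .union .new .new .work]

/-- `repeat new ← new ∪ (CPre_O(new) \ excluded) until a fixed point is reached`. -/
def saturate : Prog (Data m) (Reg m) :=
  .repeatUntil
    (.block [
      .copy .prev .new,
      .stepOp (.cpre .odd) .work .new,
      .setOp .diff .work .work .excluded,
      .setOp .union .new .new .work])
    (.eq .new .prev)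

open Classical in
/-- Compute the updated set `S_r` in the register `new`. -/
noncomputable def updateSet (r : Rank m) : Prog (Data m) (Reg m) :=
  if r ≠ ⊤ then
    .block [
      .forEach ((List.finRange (c / 2)).filter fun k => (oddPrio k).val ≤ level r) (addOdd m r),
      clear m .excluded,
      .forEach ((List.finRange c).filter fun i => level r < i.val) fun i =>
        .setOp .union .excluded .excluded (.prio i),
      saturate m]
  else
    .block [
      .forEach (List.finRange (c / 2)) (addOdd m r),
      clear m .excluded,
      saturate m]

/-- Compute the next value of `r`: go down from `r` to the largest `r' < r` with `S_{r'} ⊇ S_r`. If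
`r'` is the predecessor of `r`, then the next rank is processed, or the main loop is left
if `r = ⊤`; otherwise the algorithm continues with the rank `incr r'`. -/
noncomputable def updateRank : Prog (Data m) (Reg m) :=
  .block [
    .modify fun d => { d with r' := decr d.r },
    .withData fun d => reconstruct m d.r' .work,
    .ite (.subset .new .work)
      (.ite (.data fun d => d.r < ⊤)
        (.modify fun d => { d with r := incr d.r })
        (.modify fun d => { d with done := true }))
      (.block [
        .repeatUntil
          (.block [
            .modify fun d => { d with r' := decr d.r' },
            .withData fun d => reconstruct m d.r' .work])
          (.subset .new .work),
        .modify fun d => { d with r := incr d.r' }])]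

/-- Store the updated set `S_r`: the vertices in `new \ old` get the rank `r`. -/
noncomputable def storeSet (r : Rank m) : Prog (Data m) (Reg m) :=
  .block [
    .setOp .diff .aux .new .old,
    .forEach (List.finRange (c / 2)) fun k =>
      .forEach (List.finRange (coordMax m (oddPrio k) + 1)) fun x =>
        .setOp .diff (.coord k x) (.coord k x) .aux,
    match r with
    | none => .setOp .union .top .top .aux
    | some r =>
      .forEach (List.finRange (c / 2)) fun k =>
        .setOp .union (.coord k (ofColex r (oddPrio k))) (.coord k (ofColex r (oddPrio k))) .aux]

/-- Algorithm `SymbolicParityDominion` with the codomain `M_G^∞`, in the version that stores the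
sets `C^i_x` and `S_⊤` instead of all sets `S_r`. -/
noncomputable def symbolicParityDominion : Prog (Data m) (Reg m) :=
  .block [
    initialise m,
    .modify fun d => { d with r := incr (zeroRank m), done := false },
    .while (.data fun d => d.done = false)
      (.withData fun d =>
        .block [
          reconstruct m d.r .old,
          .copy .new .old,
          updateSet m d.r,
          updateRank m,
          storeSet m d.r]),
    .setOp .diff .result .all .top]

/-- The registers `all` and `prio i` hold the input sets; nothing is said about the others. -/
def HoldsInput {V : Type*} (G : ParityGame V c) (s : State V (Data m) (Reg m)) : Prop :=
  s.reg .all = Set.univ ∧ ∀ i, s.reg (.prio i) = G.prioSet i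

end Algorithm

/-- `ξ(n, c) = (n / ⌊c / 2⌋) ^ ⌊c / 2⌋`; for `c = 1` this is `1`. -/
noncomputable def xi (n c : ℕ) : ℝ := ((n : ℝ) / ((c / 2 : ℕ) : ℝ)) ^ (c / 2)

end SymbolicParity

namespace SymbolicParity

/-! ## Ranks -/

section RankTheory

variable {c : ℕ} {m : Fin c → ℕ}

/-! The algorithm computes the least progress measure, and that measure determines the winning sets.
Progress measures are handled by thresholds: `IsProgress` demands for each rank `q` a closure
property of the sets `S_q = {v | q ≤ ρ v}`, which are the sets that the algorithm manipulates. The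
translation rests on `le_incrAt_iff_of_even` and `le_incrAt_iff_of_odd`: for a truncated `q > 0̄`,
the condition `q ≤ incr_ℓ(x)` means `q ≤ x` if `ℓ` is even and `decr_ℓ(q) ≤ x` if `ℓ` is odd. So the
condition at `q` involves only `S_q` and sets of smaller rank.

Winning sets. If `ρ v ≠ ⊤`, player even moves so that the required inequality holds along the play;
a highest recurring odd priority would make truncated ranks decrease forever
(`wins_even_of_incrAt_le`). Conversely, positional determinacy (`splits`, by Zielonka's recursion)
covers the game by two dominions. On even's dominion, counting the reachable vertices of each odd
priority gives a progress measure without the value `⊤`, so vertices where the least measure is `⊤`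
lie in odd's dominion (`IsProgress.winning_sets`).

Main loop. The invariant says that `ρ` lies below every progress measure and that the conditions at
all ranks below the current `r` hold. The updated `S` is the least set closed under the condition at
`r`, so raising `S \ S_r` to rank `r` stays below every progress measure. Let `f` be the largest
rank below `r` with `S ⊆ S_f`. The sets `S_q` with `q ≤ f` do not change, so the conditions up to
`f` survive. If `f` is the predecessor of `r`, the condition at `r` holds as well and `r` may
advance; otherwise the loop resumes just above `f`.

Running time. Let `N` be the number of rank vectors. If `r` falls back, some vertex of rank exactly
`f` is raised to `r`, so the sum of all rank positions pays for the descent. A potential of size at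
most `(2n + 1) N` thus bounds the sum, over all iterations, of the number of raised vertices plus
the number of inspected ranks. Each unit of this costs `O(c)` one-step operations and `O(c n)` basic
ones.

Counting. `N` is the product of `n_i + 1` over odd `i`. Charging the `1` to the even class
`P_{i-1}`, nonempty except possibly for `P_0`, bounds the sum of these factors by `n + 1`; the
inequality of the means and `(1 + 1/n)^k ≤ e` for `k ≤ n` then give `N ≤ 3 ξ(n, c)`. -/

instance : Finite (RankVec m) := inferInstanceAs (Finite ((i : Fin c) → Fin (coordMax m i + 1)))

instance : Finite (Rank m) := inferInstanceAs (Finite (Option (RankVec m)))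

theorem zeroVec_le (x : RankVec m) : zeroVec m ≤ x :=
  Pi.toColex_monotone (a := fun _ => 0) (b := ofColex x) fun _ => Fin.zero_le _

theorem zeroRank_le (r : Rank m) : zeroRank m ≤ r := by
  induction r using WithTop.recTopCoe with
  | top => exact le_top
  | coe x => exact WithTop.coe_le_coe.2 (zeroVec_le x)

theorem zeroRank_lt_top : zeroRank m < ⊤ := WithTop.coe_lt_top _

theorem exists_isLeast_rank {s : Set (Rank m)} (hs : s.Nonempty) : ∃ y, IsLeast s y := by
  obtain ⟨y, hy, hy'⟩ := s.toFinite.exists_minimal hs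
  exact ⟨y, hy, fun z hz => (le_total y z).elim id fun h => hy' hz h⟩

theorem exists_isGreatest_rank {s : Set (Rank m)} (hs : s.Nonempty) : ∃ y, IsGreatest s y := by
  obtain ⟨y, hy, hy'⟩ := s.toFinite.exists_maximal hs
  exact ⟨y, hy, fun z hz => (le_total z y).elim id fun h => hy' hz h⟩

theorem isLeast_leastRank {p : Rank m → Prop} (h : ∃ y, p y) : IsLeast {y | p y} (leastRank p) := by
  have h' := exists_isLeast_rank (s := {y | p y}) h
  rw [leastRank, dif_pos h']
  exact h'.choose_spec

theorem isGreatest_greatestRank {p : Rank m → Prop} (h : ∃ y, p y) :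
    IsGreatest {y | p y} (greatestRank p) := by
  have h' := exists_isGreatest_rank (s := {y | p y}) h
  rw [greatestRank, dif_pos h']
  exact h'.choose_spec

theorem isLeast_incr {r : Rank m} (h : r < ⊤) : IsLeast {y | r < y} (incr r) :=
  isLeast_leastRank ⟨⊤, h⟩

theorem isGreatest_decr {r : Rank m} (h : zeroRank m < r) : IsGreatest {y | y < r} (decr r) :=
  isGreatest_greatestRank ⟨zeroRank m, h⟩

theorem decr_lt {r : Rank m} (h : zeroRank m < r) : decr r < r := (isGreatest_decr h).1

theorem le_decr {r q : Rank m} (h : q < r) : q ≤ decr r :=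
  (isGreatest_decr ((zeroRank_le q).trans_lt h)).2 h

theorem lt_incr {r : Rank m} (h : r < ⊤) : r < incr r := (isLeast_incr h).1

theorem incr_le {r q : Rank m} (h : r < q) : incr r ≤ q := (isLeast_incr (h.trans_le le_top)).2 h

theorem lt_incr_iff {r q : Rank m} (h : r < ⊤) : q < incr r ↔ q ≤ r :=
  ⟨fun h' => not_lt.1 fun h'' => (incr_le h'').not_gt h', fun h' => h'.trans_lt (lt_incr h)⟩

/-! ### The position of a rank in the order -/

/-- The number of ranks below `r`. -/
noncomputable def rankIndex (r : Rank m) : ℕ := (Set.Iio r).ncard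

theorem rankIndex_strictMono : StrictMono (rankIndex (m := m)) := fun x y h =>
  Set.ncard_lt_ncard ⟨fun _ hz => lt_trans hz h, fun h' => lt_irrefl x (h' h)⟩

theorem rankIndex_incr {r : Rank m} (h : r < ⊤) : rankIndex (incr r) = rankIndex r + 1 := by
  have : Set.Iio (incr r) = insert r (Set.Iio r) := by
    ext q
    simp [lt_incr_iff h, le_iff_eq_or_lt]
  rw [rankIndex, this, Set.ncard_insert_of_notMem (by simp), rankIndex]

theorem rankIndex_top : rankIndex (⊤ : Rank m) = ∏ i, (coordMax m i + 1) := by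
  have : Set.Iio (⊤ : Rank m) = Set.range ((↑) : RankVec m → Rank m) := by
    ext q
    induction q using WithTop.recTopCoe <;> simp
  rw [rankIndex, this, ← Set.image_univ, Set.ncard_image_of_injective _ WithTop.coe_injective,
    Set.ncard_univ]
  change Nat.card ((i : Fin c) → Fin (coordMax m i + 1)) = _
  simp

/-! ### Truncation of ranks -/

theorem colex_lt_iff {x y : RankVec m} : x < y ↔
    ∃ i, (∀ j, i < j → ofColex x j = ofColex y j) ∧ ofColex x i < ofColex y i := Iff.rfl

theorem projVec_le (l : ℕ) (x : RankVec m) : projVec l x ≤ x := by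
  refine Pi.toColex_monotone (a := fun i => if i.val < l then 0 else ofColex x i)
    (b := ofColex x) fun i => ?_
  dsimp only
  split_ifs
  · exact Fin.zero_le _
  · exact le_rfl

/-- The order is decided at the most significant differing entry: either truncation erases it, and
the truncated vectors coincide, or it survives and still decides. -/
theorem projVec_mono (l : ℕ) : Monotone (projVec (m := m) l) := by
  refine monotone_iff_forall_lt.2 fun x y h => ?_
  obtain ⟨i, hi, hi'⟩ := colex_lt_iff.1 h
  by_cases hl : i.val < l
  · refine le_of_eq (congrArg toColex (funext fun j => ?_))
    by_cases hj : j.val < l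
    · simp [hj]
    · simp only [hj, if_false]
      exact hi j (Fin.lt_def.2 (by omega))
  · refine (colex_lt_iff.2 ⟨i, fun j hj => ?_, ?_⟩).le
    · have : ¬ j.val < l := by have := Fin.lt_def.1 hj; omega
      simpa [projVec, this] using hi j hj
    · simpa [projVec, hl] using hi'

theorem projVec_apply (l : ℕ) (x : RankVec m) (i : Fin c) :
    ofColex (projVec l x) i = if i.val < l then 0 else ofColex x i := rfl

theorem projVec_projVec {k l : ℕ} (h : k ≤ l) (x : RankVec m) :
    projVec l (projVec k x) = projVec l x := by
  refine ofColex.injective (funext fun j => ?_)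
  simp only [projVec_apply]
  grind

theorem projVec_projVec' {k l : ℕ} (h : k ≤ l) (x : RankVec m) :
    projVec k (projVec l x) = projVec l x := by
  refine ofColex.injective (funext fun j => ?_)
  simp only [projVec_apply]
  grind

theorem proj_top (l : ℕ) : proj l (⊤ : Rank m) = ⊤ := rfl

theorem proj_coe (l : ℕ) (x : RankVec m) : proj l (x : Rank m) = (projVec l x : RankVec m) := rfl

theorem proj_eq_top {l : ℕ} {x : Rank m} : proj l x = ⊤ ↔ x = ⊤ := WithTop.map_eq_top_iff

theorem proj_le (l : ℕ) (x : Rank m) : proj l x ≤ x := by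
  induction x using WithTop.recTopCoe with
  | top => exact le_top
  | coe x => exact WithTop.coe_le_coe.2 (projVec_le l x)

theorem proj_mono (l : ℕ) : Monotone (proj (m := m) l) := (projVec_mono l).withTop_map

theorem proj_proj {k l : ℕ} (h : k ≤ l) (x : Rank m) : proj l (proj k x) = proj l x := by
  induction x using WithTop.recTopCoe with
  | top => rfl
  | coe x => exact congrArg WithTop.some (projVec_projVec h x)

theorem proj_proj' {k l : ℕ} (h : k ≤ l) (x : Rank m) : proj k (proj l x) = proj l x := by
  induction x using WithTop.recTopCoe with
  | top => rfl
  | coe x => exact congrArg WithTop.some (projVec_projVec' h x)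

theorem proj_eq_of_le {k l : ℕ} (h : k ≤ l) {r : Rank m} (hr : r = proj l r) : r = proj k r := by
  rw [hr, proj_proj' h]

theorem proj_zero (x : Rank m) : proj 0 x = x := by
  induction x using WithTop.recTopCoe with
  | top => rfl
  | coe x =>
    have h : projVec 0 x = x := congrArg toColex (funext fun j => if_neg (Nat.not_lt_zero _))
    exact congrArg WithTop.some h

/-- The sets of vectors fixed by truncation shrink as the index grows, so the comparison with the
maximal index is the fixed-point condition itself. This replaces `level` by a condition that also
makes sense for `⊤`. -/
theorem le_level_iff (r : Rank m) (i : Fin c) : i.val ≤ level r ↔ r = proj i.val r := by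
  classical
  constructor
  · intro h
    refine proj_eq_of_le h ?_
    exact Nat.findGreatest_spec (P := fun l => r = proj l r) (Nat.zero_le (c - 1))
      (proj_zero r).symm
  · intro h
    exact Nat.le_findGreatest (by omega) h

/-! ### The operations `incrAt` and `decrAt` -/

theorem incrAt_top (l : ℕ) : incrAt l (⊤ : Rank m) = ⊤ := if_pos rfl

theorem incrAt_of_even {l : ℕ} (hl : Even l) (x : Rank m) : incrAt l x = proj l x := by
  by_cases hx : x = ⊤
  · rw [hx, incrAt_top, proj_top]
  · rw [incrAt, if_neg hx, if_pos hl]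

theorem isLeast_incrAt {l : ℕ} (hl : Odd l) {x : Rank m} (hx : x ≠ ⊤) :
    IsLeast {y | proj l x < proj l y} (incrAt l x) := by
  rw [incrAt, if_neg hx, if_neg (Nat.not_even_iff_odd.2 hl)]
  refine isLeast_leastRank ⟨⊤, ?_⟩
  rw [proj_top, lt_top_iff_ne_top]
  exact fun h => hx (proj_eq_top.1 h)

theorem proj_incrAt (l : ℕ) (x : Rank m) : incrAt l x = proj l (incrAt l x) := by
  rcases Nat.even_or_odd l with hl | hl
  · rw [incrAt_of_even hl, proj_proj le_rfl]
  · by_cases hx : x = ⊤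
    · rw [hx, incrAt_top, proj_top]
    · have h := isLeast_incrAt hl hx
      refine le_antisymm (h.2 ?_) (proj_le _ _)
      change proj l x < proj l (proj l _)
      rw [proj_proj le_rfl]
      exact h.1

theorem incrAt_mono (l : ℕ) : Monotone (incrAt (m := m) l) := by
  intro x y h
  rcases Nat.even_or_odd l with hl | hl
  · rw [incrAt_of_even hl, incrAt_of_even hl]
    exact proj_mono l h
  · by_cases hy : y = ⊤
    · rw [hy, incrAt_top]
      exact le_top
    · have hx : x ≠ ⊤ := fun hx => hy (top_le_iff.1 (hx ▸ h))
      exact (isLeast_incrAt hl hx).2 ((proj_mono l h).trans_lt (isLeast_incrAt hl hy).1)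

/-- Truncation is the greatest truncated rank below `x`, so a truncated `r` cannot tell it from `x`.
-/
theorem le_incrAt_iff_of_even {l : ℕ} (hl : Even l) {r x : Rank m} (hr : r = proj l r) :
    r ≤ incrAt l x ↔ r ≤ x := by
  rw [incrAt_of_even hl]
  refine ⟨fun h => h.trans (proj_le l x), fun h => ?_⟩
  rw [hr]
  exact proj_mono l h

/-- Needed for odd `l`, too: the saturation step adds controllable predecessors of every admitted
priority, and this shows that doing so never overshoots a progress measure. -/
theorem le_incrAt {l : ℕ} {r x : Rank m} (hr : r = proj l r) (h : r ≤ x) : r ≤ incrAt l x := by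
  rcases Nat.even_or_odd l with hl | hl
  · exact (le_incrAt_iff_of_even hl hr).2 h
  · by_cases hx : x = ⊤
    · rw [hx, incrAt_top]
      exact le_top
    · rw [proj_incrAt, hr]
      exact (proj_mono l h).trans (isLeast_incrAt hl hx).1.le

/-- The predecessor of a truncated rank truncates to something smaller, and no truncated rank lies
strictly between. Hence the set minimised in `decrAt` is nonempty and its default `⊤` does not
occur. -/
theorem incrAt_decr {l : ℕ} (hl : Odd l) {r : Rank m} (hr : r = proj l r) (h0 : zeroRank m < r) :
    incrAt l (decr r) = r := by
  have hd := decr_lt h0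
  have h := isLeast_incrAt hl (hd.trans_le le_top).ne
  refine le_antisymm (h.2 ?_) ?_
  · change proj l (decr r) < proj l r
    rw [← hr]
    exact (proj_le _ _).trans_lt hd
  · by_contra hlt
    exact h.1.not_ge (proj_mono l (le_decr (not_le.1 hlt)))

theorem isLeast_decrAt {l : ℕ} (hl : Odd l) {r : Rank m} (hr : r = proj l r)
    (h0 : zeroRank m < r) : IsLeast {y | y ≠ ⊤ ∧ r = incrAt l y} (decrAt l r) := by
  rw [decrAt, if_neg (by rw [← hr]; exact h0.ne')]
  exact isLeast_leastRank
    ⟨decr r, ((decr_lt h0).trans_le le_top).ne, (incrAt_decr hl hr h0).symm⟩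

theorem decrAt_lt {l : ℕ} (hl : Odd l) {r : Rank m} (hr : r = proj l r) (h0 : zeroRank m < r) :
    decrAt l r < r :=
  ((isLeast_decrAt hl hr h0).2 ⟨((decr_lt h0).trans_le le_top).ne,
    (incrAt_decr hl hr h0).symm⟩).trans_lt (decr_lt h0)

/-- `decrAt l` is the lower adjoint of `incrAt l` on truncated positive ranks; this is why the
algorithm looks at `S_{decr_i(r)}`. -/
theorem le_incrAt_iff_of_odd {l : ℕ} (hl : Odd l) {r x : Rank m} (hr : r = proj l r)
    (h0 : zeroRank m < r) : r ≤ incrAt l x ↔ decrAt l r ≤ x := by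
  have hd := isLeast_decrAt hl hr h0
  constructor
  · intro h
    by_contra hx
    replace hx := not_le.1 hx
    -- Monotonicity squeezes `incrAt l x` between `r` and `incrAt l (decr r) = r`, against the
    -- minimality of `decrAt l r`.
    have hx' : x ≤ decr r := le_decr (hx.trans (decrAt_lt hl hr h0))
    have : r = incrAt l x :=
      le_antisymm h ((incrAt_mono l hx').trans (incrAt_decr hl hr h0).le)
    exact (hd.2 ⟨(hx.trans_le le_top).ne, this⟩).not_gt hx
  · intro h
    exact hd.1.2.le.trans (incrAt_mono l h)

/-- Truncations are not increased when a priority is passed, and they are decreased by the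
highest priority if it is odd. -/
theorem proj_le_of_incrAt_le {j i : ℕ} (h : j ≤ i) {x y : Rank m} (hxy : incrAt j x ≤ y) :
    proj i x ≤ proj i y := by
  rcases Nat.even_or_odd j with hj | hj
  · rw [incrAt_of_even hj] at hxy
    rw [← proj_proj h x]
    exact proj_mono i hxy
  · by_cases hx : x = ⊤
    · rw [hx, incrAt_top] at hxy
      rw [hx, top_le_iff.1 hxy]
    · rw [← proj_proj h x]
      refine proj_mono i (le_trans ?_ hxy)
      rw [proj_incrAt]
      exact (isLeast_incrAt hj hx).1.le

theorem proj_lt_of_incrAt_le {i : ℕ} (hi : Odd i) {x y : Rank m} (hx : x ≠ ⊤)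
    (hxy : incrAt i x ≤ y) : proj i x < proj i y :=
  (isLeast_incrAt hi hx).1.trans_le (proj_mono i hxy)

end RankTheory

/-! ## Positional determinacy of parity games -/

/-- The opponent of a player. -/
def Player.opp : Player → Player
  | .even => .odd
  | .odd => .even

/-- The priorities that are good for a player. -/
def Player.Good : Player → ℕ → Prop
  | .even => Even
  | .odd => Odd

theorem Player.opp_opp (z : Player) : z.opp.opp = z := by cases z <;> rfl

theorem Player.ne_iff {y z : Player} : y ≠ z ↔ y = z.opp := by
  cases y <;> cases z <;> simp [Player.opp]

theorem Player.ne_opp_iff {y z : Player} : y ≠ z.opp ↔ y = z := by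
  rw [Player.ne_iff, Player.opp_opp]

theorem Player.exists_good (i : ℕ) : ∃ z : Player, z.Good i :=
  (Nat.even_or_odd i).elim (fun h => ⟨.even, h⟩) fun h => ⟨.odd, h⟩

namespace ParityGame

variable {V : Type*} {c : ℕ} (G : ParityGame V c)

/-- Player `z` wins the infinite path `p`. -/
def Wins (z : Player) (p : ℕ → V) : Prop :=
  ∃ i : Fin c, IsGreatest (G.infinitelyOften p) i ∧ z.Good i.val

variable {G}

theorem infinitelyOften_shift (p : ℕ → V) (N : ℕ) :
    G.infinitelyOften (fun t => p (t + N)) = G.infinitelyOften p := by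
  ext i
  have h := Filter.map_add_atTop_eq_nat N
  change (∃ᶠ t in Filter.atTop, G.prio (p (t + N)) = i) ↔ ∃ᶠ t in Filter.atTop, G.prio (p t) = i
  conv_rhs => rw [← h, Filter.frequently_map]

theorem wins_shift {z : Player} {p : ℕ → V} {N : ℕ} :
    G.Wins z (fun t => p (t + N)) ↔ G.Wins z p := by
  rw [Wins, Wins, infinitelyOften_shift]

variable (G)

/-- An infinite path in which player `z` follows the positional strategy `f`. -/
structure Follows (z : Player) (f : V → V) (p : ℕ → V) : Prop where
  edge : ∀ t, G.Edge (p t) (p (t + 1))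
  own : ∀ t, G.owner (p t) = z → p (t + 1) = f (p t)

/-- `W` is a dominion of player `z` in the subgame `U`, with the positional winning strategy `f`. -/
structure IsDominion (U : Set V) (z : Player) (W : Set V) (f : V → V) : Prop where
  subset : W ⊆ U
  own : ∀ v ∈ W, G.owner v = z → G.Edge v (f v) ∧ f v ∈ W
  opp : ∀ v ∈ W, G.owner v ≠ z → ∀ w ∈ U, G.Edge v w → w ∈ W
  wins : ∀ p : ℕ → V, (∀ t, p t ∈ W) → G.Follows z f p → G.Wins z p

variable {G}

theorem Follows.shift {z : Player} {f : V → V} {p : ℕ → V} (h : G.Follows z f p) (N : ℕ) :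
    G.Follows z f fun t => p (t + N) := by
  refine ⟨fun t => ?_, fun t ht => ?_⟩
  · have := h.edge (t + N)
    rwa [show t + N + 1 = t + 1 + N by omega] at this
  · have := h.own (t + N) ht
    rwa [show t + N + 1 = t + 1 + N by omega] at this

theorem Follows.congr {z : Player} {f g : V → V} {p : ℕ → V} (h : G.Follows z f p)
    (hfg : ∀ t, f (p t) = g (p t)) : G.Follows z g p :=
  ⟨h.edge, fun t ht => (h.own t ht).trans (hfg t)⟩

theorem isDominion_empty (U : Set V) (z : Player) (f : V → V) : G.IsDominion U z ∅ f :=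
  ⟨Set.empty_subset U, fun _ h => h.elim, fun _ h => h.elim, fun _ h => (h 0).elim⟩

/-! ### Attractors -/

variable (G)

/-- The vertices of `U` from which player `z` can reach `T` within `k` steps in the subgame `U`. -/
def attrStage (U : Set V) (z : Player) (T : Set V) : ℕ → Set V
  | 0 => T ∩ U
  | k + 1 => attrStage U z T k ∪
      {v | v ∈ U ∧ G.owner v = z ∧ ∃ w ∈ attrStage U z T k, G.Edge v w} ∪
      {v | v ∈ U ∧ G.owner v ≠ z ∧ ∀ w ∈ U, G.Edge v w → w ∈ attrStage U z T k}

variable {G}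

theorem attrStage_mono (U : Set V) (z : Player) (T : Set V) : Monotone (G.attrStage U z T) :=
  monotone_nat_of_le_succ fun _ _ hv => Or.inl (Or.inl hv)

theorem attrStage_subset (U : Set V) (z : Player) (T : Set V) (k : ℕ) :
    G.attrStage U z T k ⊆ U := by
  induction k with
  | zero => exact Set.inter_subset_right
  | succ k ih =>
    rintro v ((hv | hv) | hv)
    · exact ih hv
    · exact hv.1
    · exact hv.1

/-- `A` is an attractor of `T` for player `z` in the subgame `U`; outside of `T` the strategy `f`
decreases the distance `rk`. -/
structure IsAttractor (G : ParityGame V c) (U : Set V) (z : Player) (T A : Set V) (f : V → V)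
    (rk : V → ℕ) : Prop where
  target : T ⊆ A
  subset : A ⊆ U
  own : ∀ v ∈ A, v ∉ T → G.owner v = z → G.Edge v (f v) ∧ f v ∈ A ∧ rk (f v) < rk v
  opp : ∀ v ∈ A, v ∉ T → G.owner v ≠ z → ∀ w ∈ U, G.Edge v w → w ∈ A ∧ rk w < rk v
  own_compl : ∀ v ∈ U, v ∉ A → G.owner v = z → ∀ w ∈ A, ¬ G.Edge v w
  opp_compl : ∀ v ∈ U, v ∉ A → G.owner v ≠ z → ∃ w ∈ U, w ∉ A ∧ G.Edge v w

/-- The attractor is the union of the stages, and `rk` is the first stage that contains a vertex; a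
vertex outside of the target enters only because of vertices of an earlier stage. -/
theorem exists_isAttractor [Finite V] (U : Set V) (z : Player) {T : Set V} (hT : T ⊆ U) :
    ∃ A f rk, G.IsAttractor U z T A f rk := by
  classical
  cases nonempty_fintype V
  set S := G.attrStage U z T with hS
  let A : Set V := {v | ∃ k, v ∈ S k}
  let rk : V → ℕ := fun v => if h : ∃ k, v ∈ S k then Nat.find h else 0
  have rk_mem : ∀ v ∈ A, v ∈ S (rk v) := by
    intro v hv
    have hv' : ∃ k, v ∈ S k := hv
    simp only [rk, dif_pos hv']
    exact Nat.find_spec hv'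
  have rk_le : ∀ v k, v ∈ S k → rk v ≤ k := by
    intro v k hv
    have hv' : ∃ k, v ∈ S k := ⟨k, hv⟩
    simp only [rk, dif_pos hv']
    exact Nat.find_min' hv' hv
  have step : ∀ v ∈ A, v ∉ T → (G.owner v = z ∧ ∃ w ∈ A, G.Edge v w ∧ rk w < rk v) ∨
      (G.owner v ≠ z ∧ ∀ w ∈ U, G.Edge v w → w ∈ A ∧ rk w < rk v) := by
    intro v hv hvT
    have hm := rk_mem v hv
    obtain h0 | ⟨k, hk⟩ : rk v = 0 ∨ ∃ k, rk v = k + 1 := by cases rk v <;> simp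
    · rw [h0] at hm
      exact absurd hm.1 hvT
    · rw [hk] at hm
      rcases hm with (hm | hm) | hm
      · have := rk_le v k hm
        omega
      · obtain ⟨-, ho, w, hw, he⟩ := hm
        refine Or.inl ⟨ho, w, ⟨k, hw⟩, he, ?_⟩
        have := rk_le w k hw
        omega
      · refine Or.inr ⟨hm.2.1, fun w hw he => ⟨⟨k, hm.2.2 w hw he⟩, ?_⟩⟩
        have := rk_le w k (hm.2.2 w hw he)
        omega
  have hf : ∀ v, ∃ u, v ∈ A → v ∉ T → G.owner v = z → G.Edge v u ∧ u ∈ A ∧ rk u < rk v := by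
    intro v
    by_cases h : v ∈ A ∧ v ∉ T ∧ G.owner v = z
    · rcases step v h.1 h.2.1 with ⟨-, w, hw, he, hr⟩ | ⟨hn, -⟩
      · exact ⟨w, fun _ _ _ => ⟨he, hw, hr⟩⟩
      · exact absurd h.2.2 hn
    · exact ⟨v, fun h1 h2 h3 => absurd ⟨h1, h2, h3⟩ h⟩
  choose f hf using hf
  refine ⟨A, f, rk, fun v hv => ⟨0, hv, hT hv⟩, ?_, hf, ?_, ?_, ?_⟩
  · rintro v ⟨k, hk⟩
    exact attrStage_subset U z T k hk
  · intro v hv hvT ho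
    rcases step v hv hvT with ⟨h, -⟩ | ⟨-, h⟩
    · exact absurd h ho
    · exact h
  · rintro v hvU hvA ho w ⟨k, hk⟩ he
    exact hvA ⟨k + 1, Or.inl (Or.inr ⟨hvU, ho, w, hk, he⟩)⟩
  · intro v hvU hvA ho
    by_contra! hall
    -- If all successors in `U` were attracted, they would all be present at the stage `sup rk`, so
    -- `v` would enter one stage later.
    refine hvA ⟨Finset.univ.sup rk + 1, Or.inr ⟨hvU, ho, fun w hw he => ?_⟩⟩
    have hwA : w ∈ A := by
      by_contra h
      exact hall w hw h he
    exact attrStage_mono U z T (Finset.le_sup (f := rk) (Finset.mem_univ w)) (rk_mem w hwA)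

theorem IsAttractor.exists_mem {U : Set V} {z : Player} {T A : Set V} {f : V → V} {rk : V → ℕ}
    (h : G.IsAttractor U z T A f rk) {p : ℕ → V} (hU : ∀ t, p t ∈ U)
    (he : ∀ t, G.Edge (p t) (p (t + 1)))
    (ho : ∀ t, p t ∈ A → p t ∉ T → G.owner (p t) = z → p (t + 1) = f (p t))
    (t : ℕ) (ht : p t ∈ A) : ∃ t' ≥ t, p t' ∈ T := by
  induction hn : rk (p t) using Nat.strong_induction_on generalizing t with
  | _ n ih =>
    by_cases hT : p t ∈ T
    · exact ⟨t, le_rfl, hT⟩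
    · have key : p (t + 1) ∈ A ∧ rk (p (t + 1)) < rk (p t) := by
        by_cases hz : G.owner (p t) = z
        · rw [ho t ht hT hz]
          exact (h.own _ ht hT hz).2
        · exact h.opp _ ht hT hz _ (hU _) (he t)
      obtain ⟨t', h1, h2⟩ := ih _ (hn ▸ key.2) (t + 1) key.1 rfl
      exact ⟨t', by omega, h2⟩

/-- The complement of an attractor is a subgame. -/
theorem IsAttractor.subgame {U : Set V} {z : Player} {T A : Set V} {f : V → V} {rk : V → ℕ}
    (h : G.IsAttractor U z T A f rk) (hU : ∀ v ∈ U, ∃ w ∈ U, G.Edge v w) :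
    ∀ v ∈ U \ A, ∃ w ∈ U \ A, G.Edge v w := by
  rintro v ⟨hvU, hvA⟩
  by_cases ho : G.owner v = z
  · obtain ⟨w, hw, he⟩ := hU v hvU
    exact ⟨w, ⟨hw, fun hwA => h.own_compl v hvU hvA ho w hwA he⟩, he⟩
  · obtain ⟨w, hw, hwA, he⟩ := h.opp_compl v hvU hvA ho
    exact ⟨w, ⟨hw, hwA⟩, he⟩

/-! ### Decomposition into dominions -/

variable (G) in
/-- The subgame `U` is covered by a dominion of player `z` and a dominion of the opponent. -/
def Splits (U : Set V) (z : Player) : Prop :=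
  ∃ W f W' f', U ⊆ W ∪ W' ∧ G.IsDominion U z W f ∧ G.IsDominion U z.opp W' f'

theorem Splits.opp {U : Set V} {z : Player} (h : G.Splits U z) : G.Splits U z.opp := by
  obtain ⟨W, f, W', f', h1, h2, h3⟩ := h
  exact ⟨W', f', W, f, by rwa [Set.union_comm], h3, by rwa [Player.opp_opp]⟩

theorem Splits.any {U : Set V} {z : Player} (h : G.Splits U z) (y : Player) : G.Splits U y := by
  by_cases hy : y = z
  · rwa [hy]
  · rw [Player.ne_iff.1 hy]
    exact h.opp

/-- If the opponent has no dominion outside of the attractor of the highest priority, then player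
`z` wins everywhere. -/
theorem isDominion_of_attractor {U : Set V} (hU : ∀ v ∈ U, ∃ w ∈ U, G.Edge v w) {z : Player}
    {d : Fin c} (hz : z.Good d.val) (hd : ∀ v ∈ U, G.prio v ≤ d) {A : Set V} {f g : V → V}
    {rk : V → ℕ} (hA : G.IsAttractor U z {v | v ∈ U ∧ G.prio v = d} A f rk)
    (hW : G.IsDominion (U \ A) z (U \ A) g) : ∃ h, G.IsDominion U z U h := by
  classical
  have hn : ∀ v, ∃ w, v ∈ U → w ∈ U ∧ G.Edge v w := fun v => by
    by_cases hv : v ∈ U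
    · obtain ⟨w, hw⟩ := hU v hv
      exact ⟨w, fun _ => hw⟩
    · exact ⟨v, fun h => absurd h hv⟩
  choose n hn using hn
  refine ⟨fun v => if v ∈ A then if G.prio v = d then n v else f v else g v,
    subset_rfl, ?_, fun _ _ _ w hw _ => hw, ?_⟩
  · intro v hv ho
    by_cases hvA : v ∈ A
    · by_cases hvd : G.prio v = d
      · simpa [hvA, hvd] using (hn v hv).symm
      · have := hA.own v hvA (fun h => hvd h.2) ho
        simpa [hvA, hvd] using ⟨this.1, hA.subset this.2.1⟩
    · have := hW.own v ⟨hv, hvA⟩ ho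
      simpa [hvA] using ⟨this.1, this.2.1⟩
  · intro p hp hf
    -- Either the play finally stays outside of `A`, where `g` wins, or it meets `A` infinitely
    -- often, and each time is driven to the top priority `d`.
    by_cases hfr : ∃ N, ∀ t ≥ N, p t ∉ A
    · obtain ⟨N, hN⟩ := hfr
      refine wins_shift.1 (hW.wins (fun t => p (t + N)) (fun t => ⟨hp _, hN _ (by omega)⟩)
        ((hf.shift N).congr fun t => ?_))
      simp [hN (t + N) (by omega)]
    · push Not at hfr
      refine ⟨d, ⟨Filter.frequently_atTop.2 fun N => ?_, fun i hi => ?_⟩, hz⟩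
      · obtain ⟨t, ht, htA⟩ := hfr N
        obtain ⟨t', h1, h2⟩ := hA.exists_mem hp hf.edge (fun t h1 h2 h3 => by
          rw [hf.own t h3]
          have : ¬ G.prio (p t) = d := fun h => h2 ⟨hp t, h⟩
          simp [h1, this]) t htA
        exact ⟨t', by omega, h2.2⟩
      · obtain ⟨t, ht⟩ := Filter.Frequently.exists hi
        exact ht ▸ hd _ (hp t)

/-- A dominion of the subgame `U \ A`, where `A` is an attractor of the opponent, is enlarged by
solving the rest of the game. -/
theorem splits_of_dominion {U : Set V} {z : Player} {T A : Set V} {f : V → V} {rk : V → ℕ}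
    (hA : G.IsAttractor U z.opp T A f rk) {D : Set V} {g : V → V}
    (hD : G.IsDominion (U \ A) z D g) {B : Set V} {h : V → V} {rk' : V → ℕ}
    (hB : G.IsAttractor U z D B h rk') (hS : G.Splits (U \ B) z) : G.Splits U z := by
  classical
  obtain ⟨W, k, W', k', hcov, hW, hW'⟩ := hS
  -- `D` is closed in all of `U`: a vertex of the opponent outside of the opponent's own attractor
  -- `A` has no edge into `A`.
  have hDopp : ∀ v ∈ D, G.owner v ≠ z → ∀ w ∈ U, G.Edge v w → w ∈ D := by
    intro v hv ho w hw he
    refine hD.opp v hv ho w ⟨hw, fun hwA => ?_⟩ he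
    have hv' := hD.subset hv
    exact hA.own_compl v hv'.1 hv'.2 (Player.ne_iff.1 ho) w hwA he
  refine ⟨W ∪ B, fun v => if v ∈ D then g v else if v ∈ B then h v else k v, W', k', ?_, ?_, ?_⟩
  · intro v hv
    by_cases hvB : v ∈ B
    · exact Or.inl (Or.inr hvB)
    · exact (hcov ⟨hv, hvB⟩).imp Or.inl id
  · refine ⟨Set.union_subset (hW.subset.trans Set.sdiff_subset) hB.subset, ?_, ?_, ?_⟩
    · intro v hv ho
      by_cases hvD : v ∈ D
      · have := hD.own v hvD ho
        simpa [hvD] using ⟨this.1, Or.inr (hB.target this.2)⟩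
      · by_cases hvB : v ∈ B
        · have := hB.own v hvB hvD ho
          simpa [hvD, hvB] using ⟨this.1, Or.inr this.2.1⟩
        · have := hW.own v (hv.resolve_right hvB) ho
          simpa [hvD, hvB] using ⟨this.1, Or.inl this.2⟩
    · intro v hv ho w hw he
      by_cases hvD : v ∈ D
      · exact Or.inr (hB.target (hDopp v hvD ho w hw he))
      · by_cases hvB : v ∈ B
        · exact Or.inr (hB.opp v hvB hvD ho w hw he).1
        · by_cases hwB : w ∈ B
          · exact Or.inr hwB
          · exact Or.inl (hW.opp v (hv.resolve_right hvB) ho w ⟨hw, hwB⟩ he)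
    · intro p hp hf
      have hpU : ∀ t, p t ∈ U := fun t =>
        (hp t).elim (fun h => (hW.subset h).1) fun h => hB.subset h
      -- A play that meets `B` is attracted to `D` and trapped there; any other play stays in `W`,
      -- where `k` wins.
      by_cases hex : ∃ t, p t ∈ B
      · obtain ⟨t, ht⟩ := hex
        obtain ⟨N, -, hN⟩ := hB.exists_mem hpU hf.edge (fun t h1 h2 h3 => by
          rw [hf.own t h3]
          simp [h1, h2]) t ht
        have hstay : ∀ t, p (t + N) ∈ D := by
          intro t
          induction t with
          | zero => simpa using hN
          | succ t ih =>
            rw [show t + 1 + N = t + N + 1 by omega]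
            by_cases ho : G.owner (p (t + N)) = z
            · rw [hf.own _ ho]
              simpa [ih] using (hD.own _ ih ho).2
            · exact hDopp _ ih ho _ (hpU _) (hf.edge _)
        refine wins_shift.1 (hD.wins (fun t => p (t + N)) hstay ((hf.shift N).congr fun t => ?_))
        simp [hstay t]
      · push Not at hex
        refine hW.wins p (fun t => (hp t).resolve_right (hex t)) (hf.congr fun t => ?_)
        have : p t ∉ D := fun h => hex t (hB.target h)
        simp [this, hex t]
  -- The opponent's dominion needs no change: player `z` has no edge into `B` from outside of `B`.
  · refine ⟨hW'.subset.trans Set.sdiff_subset, hW'.own, fun v hv ho w hw he => ?_, hW'.wins⟩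
    have hv' := hW'.subset hv
    exact hW'.opp v hv ho w
      ⟨hw, fun hwB => hB.own_compl v hv'.1 hv'.2 (Player.ne_opp_iff.1 ho) w hwB he⟩ he

/-- **Positional determinacy**: every subgame is covered by dominions of the two players. -/
theorem splits [Finite V] (U : Set V) (hU : ∀ v ∈ U, ∃ w ∈ U, G.Edge v w) (z : Player) :
    G.Splits U z := by
  induction hn : U.ncard using Nat.strong_induction_on generalizing U z with
  | _ n ih =>
    rcases U.eq_empty_or_nonempty with rfl | hne
    · exact ⟨∅, id, ∅, id, by simp, isDominion_empty _ _ _, isDominion_empty _ _ _⟩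
    obtain ⟨u, huU, hu⟩ := U.exists_max_image G.prio U.toFinite hne
    obtain ⟨y, hy⟩ := Player.exists_good (G.prio u).val
    refine Splits.any (z := y) ?_ z
    have hlt : ∀ B : Set V, B ⊆ U → B.Nonempty → (U \ B).ncard < n := by
      rintro B hB ⟨v, hv⟩
      rw [← hn]
      exact Set.ncard_lt_ncard ⟨Set.sdiff_subset, fun h => (h (hB hv)).2 hv⟩
    obtain ⟨A, f, rk, hA⟩ := exists_isAttractor (G := G) U y
      (T := {v | v ∈ U ∧ G.prio v = G.prio u}) fun v hv => hv.1
    obtain ⟨W, g, W', g', hcov, hW, hW'⟩ := ih _ (hlt A hA.subset ⟨u, hA.target ⟨huU, rfl⟩⟩)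
      (U \ A) (hA.subgame hU) y rfl
    -- Zielonka's case distinction: player `y`, for whom the top priority is good, wins everywhere,
    -- or the opponent's nonempty dominion is attracted away and the smaller rest is solved.
    rcases W'.eq_empty_or_nonempty with rfl | hne'
    · rw [Set.union_empty] at hcov
      rw [hW.subset.antisymm hcov] at hW
      obtain ⟨k, hk⟩ := isDominion_of_attractor hU hy hu hA hW
      exact ⟨U, k, ∅, id, by simp, hk, isDominion_empty _ _ _⟩
    · obtain ⟨B, h, rk', hB⟩ := exists_isAttractor (G := G) U y.opp
        (T := W') (hW'.subset.trans Set.sdiff_subset)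
      have hS := ih _ (hlt B hB.subset (hne'.mono hB.target)) (U \ B) (hB.subgame hU) y.opp rfl
      have := splits_of_dominion (z := y.opp) (by rwa [Player.opp_opp]) hW' hB hS
      exact this.any y

end ParityGame

/-! ## Progress measures -/

namespace ParityGame

variable {V : Type*} {c : ℕ}

/-- A progress measure: the rank of a vertex is at least the rank that is required by the ranks of
its successors. -/
def IsProgress (G : ParityGame V c) {m : Fin c → ℕ} (ρ : V → Rank m) : Prop :=
  ∀ v q, q = proj (G.prio v).val q →
    v ∈ G.cpre .odd {w | q ≤ incrAt (G.prio v).val (ρ w)} → q ≤ ρ v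

variable {G : ParityGame V c} {m : Fin c → ℕ}

theorem cpre_mono (z : Player) : Monotone (G.cpre z) := by
  rintro A B h v (⟨ho, u, he, hu⟩ | ⟨ho, hu⟩)
  · exact Or.inl ⟨ho, u, he, h hu⟩
  · exact Or.inr ⟨ho, fun u he => h (hu u he)⟩

theorem IsProgress.le_of_odd {ρ : V → Rank m} (h : G.IsProgress ρ) {v w : V}
    (ho : G.owner v = .odd) (he : G.Edge v w) : incrAt (G.prio v).val (ρ w) ≤ ρ v :=
  h v _ (proj_incrAt _ _) (Or.inl ⟨ho, w, he, le_refl (incrAt _ _)⟩)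

/-- A best successor exists by finiteness; its requirement is a threshold met by all successors. -/
theorem IsProgress.exists_of_even [Finite V] {ρ : V → Rank m} (h : G.IsProgress ρ) {v : V}
    (ho : G.owner v = .even) : ∃ w, G.Edge v w ∧ incrAt (G.prio v).val (ρ w) ≤ ρ v := by
  obtain ⟨w, hw, hmin⟩ := Set.exists_min_image {w | G.Edge v w}
    (fun w => incrAt (G.prio v).val (ρ w)) (Set.toFinite _) (G.exists_edge v)
  refine ⟨w, hw, h v _ (proj_incrAt _ _) (Or.inr ⟨by simp [ho], fun u hu => hmin u hu⟩)⟩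

theorem exists_isGreatest_infinitelyOften (p : ℕ → V) :
    ∃ i, IsGreatest (G.infinitelyOften p) i := by
  have hne : (G.infinitelyOften p).Nonempty := by
    by_contra hcon
    rw [Set.not_nonempty_iff_eq_empty] at hcon
    have : ∀ i, ∀ᶠ t in Filter.atTop, G.prio (p t) ≠ i := fun i => by
      have hi : i ∉ G.infinitelyOften p := by simp [hcon]
      exact Filter.not_frequently.1 hi
    obtain ⟨t, ht⟩ := (Filter.eventually_all.2 this).exists
    exact ht _ rfl
  obtain ⟨i, hi, hi'⟩ := Set.exists_max_image _ id (Set.toFinite _) hne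
  exact ⟨i, hi, hi'⟩

/-- If the highest recurring priority `i` were odd, the ranks truncated at `i` would finally be
non-increasing and drop at each visit of `i`, which is impossible in a finite order. -/
theorem wins_even_of_incrAt_le {ρ : V → Rank m} {p : ℕ → V} (hp : ∀ t, ρ (p t) ≠ ⊤)
    (h : ∀ t, incrAt (G.prio (p t)).val (ρ (p (t + 1))) ≤ ρ (p t)) : G.EvenWins p := by
  obtain ⟨i, hi⟩ := exists_isGreatest_infinitelyOften (G := G) p
  refine ⟨i, hi, ?_⟩
  by_contra hodd
  rw [Nat.not_even_iff_odd] at hodd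
  have hev : ∀ j, ∀ᶠ t in Filter.atTop, i < j → G.prio (p t) ≠ j := by
    intro j
    by_cases hj : i < j
    · have : j ∉ G.infinitelyOften p := fun h => (hi.2 h).not_gt hj
      exact (Filter.not_frequently.1 this).mono fun _ h _ => h
    · exact Filter.Eventually.of_forall fun _ h => absurd h hj
  obtain ⟨N, hN⟩ := Filter.eventually_atTop.1 (Filter.eventually_all.2 hev)
  have hle : ∀ t ≥ N, G.prio (p t) ≤ i := fun t ht => by
    by_contra hcon
    exact hN t ht _ (not_le.1 hcon) rfl
  set a : ℕ → Rank m := fun t => proj i.val (ρ (p (t + N))) with ha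
  have hanti : Antitone a := antitone_nat_of_succ_le fun t => by
    have := proj_le_of_incrAt_le (Fin.le_def.1 (hle (t + N) (by omega))) (h (t + N))
    rwa [show t + N + 1 = t + 1 + N by omega] at this
  obtain ⟨y, ⟨t₀, ht₀⟩, hy⟩ := exists_isLeast_rank (Set.range_nonempty a)
  -- A visit of `i` after the truncated ranks have reached their minimum, so that the drop at this
  -- visit is a contradiction.
  obtain ⟨t, ht, hti⟩ := Filter.frequently_atTop.1 hi.1 (t₀ + N)
  have hlt : a (t - N + 1) < a (t - N) := by
    have h1 := h t
    rw [hti] at h1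
    have := proj_lt_of_incrAt_le hodd (hp _) h1
    simpa [ha, show t - N + 1 + N = t + 1 by omega, show t - N + N = t by omega] using this
  exact (hlt.trans_le (hanti (show t₀ ≤ t - N by omega))).not_ge (ht₀ ▸ hy ⟨_, rfl⟩)

theorem play_edge (σ : G.Strategy .even) (τ : G.Strategy .odd) (v : V) (t : ℕ) :
    G.Edge (G.play σ τ v t) (G.play σ τ v (t + 1)) := by
  rw [play]
  split
  · exact σ.edge_move _ (by assumption)
  · exact τ.edge_move _ (by assumption)

theorem play_of_even (σ : G.Strategy .even) (τ : G.Strategy .odd) (v : V) {t : ℕ}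
    (h : G.owner (G.play σ τ v t) = .even) : G.play σ τ v (t + 1) = σ.move (G.play σ τ v t) := by
  rw [play, h]

theorem play_of_odd (σ : G.Strategy .even) (τ : G.Strategy .odd) (v : V) {t : ℕ}
    (h : G.owner (G.play σ τ v t) = .odd) : G.play σ τ v (t + 1) = τ.move (G.play σ τ v t) := by
  rw [play, h]

/-- Player `even` wins from the vertices whose rank in a progress measure is not `⊤`. -/
theorem IsProgress.mem_winEven [Finite V] {ρ : V → Rank m} (h : G.IsProgress ρ) {v : V}
    (hv : ρ v ≠ ⊤) : v ∈ G.winEven := by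
  have hex : ∀ u, ∃ w, G.Edge u w ∧
      (G.owner u = .even → incrAt (G.prio u).val (ρ w) ≤ ρ u) := fun u => by
    by_cases hu : G.owner u = .even
    · obtain ⟨w, h1, h2⟩ := h.exists_of_even hu
      exact ⟨w, h1, fun _ => h2⟩
    · obtain ⟨w, hw⟩ := G.exists_edge u
      exact ⟨w, hw, fun h => absurd h hu⟩
  choose f hf using hex
  refine ⟨⟨f, fun u _ => (hf u).1⟩, fun τ => ?_⟩
  set p := G.play ⟨f, fun u _ => (hf u).1⟩ τ v with hp
  have hstep : ∀ t, incrAt (G.prio (p t)).val (ρ (p (t + 1))) ≤ ρ (p t) := fun t => by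
    cases ho : G.owner (p t) with
    | even =>
      rw [hp, play_of_even _ _ _ ho]
      exact (hf _).2 ho
    | odd => exact h.le_of_odd ho (play_edge _ _ _ _)
  refine wins_even_of_incrAt_le (fun t => ?_) hstep
  induction t with
  | zero => exact hv
  | succ t ih =>
    intro htop
    have := hstep t
    rw [htop, incrAt_top, top_le_iff] at this
    exact ih this

/-! ### The progress measure of a dominion -/

theorem exists_path_of_transGen {α : Type*} {r : α → α → Prop} {a b : α}
    (h : Relation.TransGen r a b) :
    ∃ (n : ℕ) (f : ℕ → α), f 0 = a ∧ f (n + 1) = b ∧ ∀ t ≤ n, r (f t) (f (t + 1)) := by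
  induction h with
  | @single b h =>
    refine ⟨0, fun t => if t = 0 then a else b, by simp, by simp, fun t ht => ?_⟩
    obtain rfl : t = 0 := by omega
    simpa using h
  | @tail b d _ h ih =>
    obtain ⟨n, f, h0, h1, h2⟩ := ih
    refine ⟨n + 1, fun t => if t ≤ n + 1 then f t else d, by simp [h0], by simp, fun t ht => ?_⟩
    rcases ht.lt_or_eq with ht' | rfl
    · simpa [ht, show t ≤ n by omega] using h2 t (by omega)
    · simpa [h1] using h

theorem exists_periodic_path {α : Type*} {r : α → α → Prop} {a : α}
    (h : Relation.TransGen r a a) :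
    ∃ p : ℕ → α, (∀ t, r (p t) (p (t + 1))) ∧ ∃ᶠ t in Filter.atTop, p t = a := by
  obtain ⟨n, f, h0, h1, h2⟩ := exists_path_of_transGen h
  refine ⟨fun t => f (t % (n + 1)), fun t => ?_, Filter.frequently_atTop.2 fun N =>
    ⟨N * (n + 1), by nlinarith, by simpa using h0⟩⟩
  dsimp only
  have hlt : t % (n + 1) < n + 1 := Nat.mod_lt _ (by omega)
  have h3 := h2 (t % (n + 1)) (by omega)
  rcases Nat.lt_or_ge (t % (n + 1)) n with hn | hn
  · rwa [show (t + 1) % (n + 1) = t % (n + 1) + 1 from by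
      rw [Nat.add_mod]
      rcases Nat.eq_zero_or_pos n with rfl | hpos
      · omega
      · rw [Nat.mod_eq_of_lt (show 1 < n + 1 by omega), Nat.mod_eq_of_lt (by omega)]]
  · have hn' : t % (n + 1) = n := by omega
    have : (t + 1) % (n + 1) = 0 := by
      rw [← Nat.mod_add_mod, hn']
      simp
    rw [this, h0, ← h1]
    rwa [hn'] at h3 ⊢

variable (G) in
/-- The moves inside `W` in which player `even` follows `f`, between vertices of priority at most
`i`. -/
def DomStep (W : Set V) (f : V → V) (i : Fin c) (a b : V) : Prop :=
  a ∈ W ∧ G.Edge a b ∧ (G.owner a = .even → b = f a) ∧ G.prio a ≤ i ∧ G.prio b ≤ i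

variable (G) in
/-- The vertices of priority `i` that are reachable without visiting higher priorities. -/
def domReach (W : Set V) (f : V → V) (i : Fin c) (v : V) : Set V :=
  {w | G.prio w = i ∧ Relation.ReflTransGen (G.DomStep W f i) v w}

theorem prio_le_of_mem_domReach {W : Set V} {f : V → V} {i : Fin c} {v w : V}
    (h : w ∈ G.domReach W f i v) : G.prio v ≤ i := by
  rcases Relation.ReflTransGen.cases_head h.2 with rfl | ⟨u, hu, -⟩
  · exact h.1.le
  · exact hu.2.2.2.1

theorem domReach_subset {W : Set V} {f : V → V} {i : Fin c} {v w : V} (hv : v ∈ W)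
    (he : G.Edge v w) (hf : G.owner v = .even → w = f v) (hi : G.prio v ≤ i) :
    G.domReach W f i w ⊆ G.domReach W f i v := fun _ hx =>
  ⟨hx.1, .head ⟨hv, he, hf, hi, prio_le_of_mem_domReach hx⟩ hx.2⟩

/-- Otherwise `v` would lie on a cycle inside `W`, consistent with `f`, whose highest priority is
the odd priority of `v`; repeating it forever would be a lost play. -/
theorem IsDominion.notMem_domReach {U W : Set V} {f : V → V} (hW : G.IsDominion U .even W f)
    {v w : V} (hv : v ∈ W) (he : G.Edge v w) (hf : G.owner v = .even → w = f v)
    (hodd : Odd (G.prio v).val) : v ∉ G.domReach W f (G.prio v) w := by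
  intro hx
  have hcyc : Relation.TransGen (G.DomStep W f (G.prio v)) v v :=
    .head' ⟨hv, he, hf, le_rfl, prio_le_of_mem_domReach hx⟩ hx.2
  obtain ⟨p, hp, hfr⟩ := exists_periodic_path hcyc
  obtain ⟨i, hi, hev⟩ := hW.wins p (fun t => (hp t).1)
    ⟨fun t => (hp t).2.1, fun t ht => (hp t).2.2.1 ht⟩
  have h1 : G.prio v ≤ i := hi.2 (hfr.mono fun t ht => by rw [ht])
  obtain ⟨t, ht⟩ := Filter.Frequently.exists hi.1
  have h2 : i ≤ G.prio v := ht ▸ (hp t).2.2.2.1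
  rw [le_antisymm h2 h1] at hev
  exact (Nat.not_even_iff_odd.2 hodd) hev

variable (G) in
/-- The number of odd vertices that can be reached for each odd priority. -/
noncomputable def domVec [Finite V] (W : Set V) (f : V → V) (v : V) : RankVec G.classSize :=
  toColex fun i => if h : Odd i.val then
    ⟨(G.domReach W f i v).ncard, by
      rw [coordMax, if_pos h, Nat.lt_succ_iff]
      exact Set.ncard_le_ncard fun w hw => hw.1⟩ else 0

theorem domVec_apply [Finite V] (W : Set V) (f : V → V) (v : V) (i : Fin c) :
    (ofColex (G.domVec W f v) i).val = if Odd i.val then (G.domReach W f i v).ncard else 0 := by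
  change (Fin.val (dite _ _ _)) = _
  split_ifs <;> rfl

/-- Everything counted from `w` at priorities at least that of `v` is also counted from `v`; if the
priority of `v` is odd, `v` itself is counted from `v` but not from `w`. -/
theorem incrAt_domVec_le [Finite V] {U W : Set V} {f : V → V} (hW : G.IsDominion U .even W f)
    {v w : V} (hv : v ∈ W) (he : G.Edge v w) (hf : G.owner v = .even → w = f v) :
    incrAt (G.prio v).val (G.domVec W f w : Rank G.classSize) ≤ G.domVec W f v := by
  have hle : ∀ i, G.prio v ≤ i →
      ofColex (G.domVec W f w) i ≤ ofColex (G.domVec W f v) i := fun i hi => by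
    rw [Fin.le_def, domVec_apply, domVec_apply]
    split_ifs
    · exact Set.ncard_le_ncard (domReach_subset hv he hf hi)
    · exact le_rfl
  rcases Nat.even_or_odd (G.prio v).val with hp | hp
  · rw [incrAt_of_even hp, proj_coe, WithTop.coe_le_coe]
    refine Pi.toColex_monotone (b := ofColex (G.domVec W f v)) fun i => ?_
    dsimp only
    split_ifs with h
    · exact Fin.zero_le _
    · exact hle i (Fin.le_def.2 (by omega))
  · refine (isLeast_incrAt hp WithTop.coe_ne_top).2 ?_
    refine WithTop.coe_lt_coe.2 (Pi.toColex_strictMono (Pi.lt_def.2 ⟨fun i => ?_, G.prio v, ?_⟩))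
    · dsimp only
      split_ifs with h
      · exact le_rfl
      · exact hle i (Fin.le_def.2 (by omega))
    · simp only [lt_self_iff_false, if_false]
      rw [Fin.lt_def, domVec_apply, domVec_apply, if_pos hp, if_pos hp]
      exact Set.ncard_lt_ncard ⟨domReach_subset hv he hf le_rfl,
        fun h => hW.notMem_domReach hv he hf hp (h ⟨rfl, .refl⟩)⟩

/-- The value `⊤` outside of `W` satisfies every condition there. Inside, the threshold is met by
some admissible successor in `W`: for player odd because the dominion cannot be left, for player
even because of `f`. -/
theorem IsDominion.exists_isProgress [Finite V] {W : Set V} {f : V → V}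
    (hW : G.IsDominion Set.univ .even W f) :
    ∃ ρ : V → Rank G.classSize, G.IsProgress ρ ∧ ∀ v ∈ W, ρ v ≠ ⊤ := by
  classical
  have hρ : ∀ v ∈ W, (if v ∈ W then (G.domVec W f v : Rank G.classSize) else ⊤) =
      G.domVec W f v := fun v hv => if_pos hv
  refine ⟨fun v => if v ∈ W then G.domVec W f v else ⊤, fun v q _ hq => ?_, fun v hv => ?_⟩
  · by_cases hv : v ∈ W
    · dsimp only at hq ⊢
      rw [hρ v hv]
      have key : ∃ w ∈ W, G.Edge v w ∧ (G.owner v = .even → w = f v) ∧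
          q ≤ incrAt (G.prio v).val (if w ∈ W then (G.domVec W f w : Rank G.classSize) else ⊤) := by
        rcases hq with ⟨ho, w, he, hw⟩ | ⟨ho, hall⟩
        · exact ⟨w, hW.opp v hv (by simp [ho]) w trivial he, he, by simp [ho], hw⟩
        · have ho' : G.owner v = .even := Player.ne_iff.1 ho
          have := hW.own v hv ho'
          exact ⟨f v, this.2, this.1, fun _ => rfl, hall _ this.1⟩
      obtain ⟨w, hwW, he, hf, hq⟩ := key
      rw [hρ w hwW] at hq
      exact hq.trans (incrAt_domVec_le hW hv he hf)
    · simp [hv]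
  · dsimp only
    rw [hρ v hv]
    exact WithTop.coe_ne_top

theorem IsDominion.subset_winOdd {W : Set V} {f : V → V}
    (hW : G.IsDominion Set.univ .odd W f) : W ⊆ G.winOdd := by
  classical
  choose g hg using G.exists_edge
  intro v hv
  let τ : G.Strategy .odd := ⟨fun u => if u ∈ W then f u else g u, fun u hu => by
    split_ifs with h
    · exact (hW.own u h hu).1
    · exact hg u⟩
  refine ⟨τ, fun σ => ?_⟩
  have hmem : ∀ t, G.play σ τ v t ∈ W := fun t => by
    induction t with
    | zero => exact hv
    | succ t ih =>
      cases ho : G.owner (G.play σ τ v t) with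
      | odd =>
        rw [play_of_odd _ _ _ ho]
        simpa [τ, ih] using (hW.own _ ih ho).2
      | even => exact hW.opp _ ih (by simp [ho]) _ trivial (play_edge _ _ _ _)
  exact hW.wins _ hmem ⟨play_edge σ τ v, fun t ht => by
    rw [play_of_odd _ _ _ ht]
    simp [τ, hmem t]⟩

theorem disjoint_winEven_winOdd : Disjoint G.winEven G.winOdd := by
  refine Set.disjoint_left.2 ?_
  rintro v ⟨σ, hσ⟩ ⟨τ, hτ⟩
  obtain ⟨i, hi, heven⟩ := hσ τ
  obtain ⟨j, hj, hodd⟩ := hτ σ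
  rw [hi.unique hj] at heven
  exact Nat.not_even_iff_odd.2 hodd heven

/-- The least progress measure describes the winning sets. -/
theorem IsProgress.winning_sets [Finite V] {ρ : V → Rank G.classSize} (h : G.IsProgress ρ)
    (hmin : ∀ ρ' : V → Rank G.classSize, G.IsProgress ρ' → ∀ v, ρ v ≤ ρ' v) :
    {v | ρ v = ⊤} = G.winOdd ∧ {v | ρ v = ⊤}ᶜ = G.winEven := by
  -- On even's dominion some progress measure avoids `⊤`, and `ρ` lies below it; so rank `⊤` forces
  -- membership in odd's dominion.
  have h1 : {v | ρ v = ⊤} ⊆ G.winOdd := by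
    obtain ⟨W, f, W', f', hcov, hW, hW'⟩ := splits (G := G) Set.univ
      (fun v _ => (G.exists_edge v).imp fun w hw => ⟨trivial, hw⟩) .even
    intro v hv
    refine (hcov (Set.mem_univ v)).elim (fun hvW => ?_) fun hvW => hW'.subset_winOdd hvW
    obtain ⟨ρ', hρ', htop⟩ := hW.exists_isProgress
    exact absurd (top_le_iff.1 (hv ▸ hmin ρ' hρ' v)) (htop v hvW)
  have h2 : {v | ρ v = ⊤}ᶜ ⊆ G.winEven := fun v hv => h.mem_winEven hv
  -- Two complementary sets inside two disjoint winning sets must be equal to them.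
  have h3 := Set.disjoint_left.1 (disjoint_winEven_winOdd (G := G))
  exact ⟨h1.antisymm fun v hv => by_contra fun hcon => h3 (h2 hcon) hv,
    h2.antisymm fun v hv hcon => h3 hv (h1 hcon)⟩

end ParityGame

/-! ## Executions of symbolic programs -/

section Programs

variable {V : Type*} {c : ℕ} {σ ρ : Type} {G : ParityGame V c}

/-- Executions are deterministic. -/
theorem Exec.deterministic {p : Prog σ ρ} {s s₁ : State V σ ρ} {a₁ b₁ : ℕ}
    (h₁ : Exec G p s s₁ a₁ b₁) : ∀ {s₂ a₂ b₂}, Exec G p s s₂ a₂ b₂ →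
      s₁ = s₂ ∧ a₁ = a₂ ∧ b₁ = b₂ := by
  induction h₁ with
  | skip | setOp | stepOp | modify =>
    intro s₂ a₂ b₂ h₂
    cases h₂
    exact ⟨rfl, rfl, rfl⟩
  | withData f s s' a b _ ih =>
    intro s₂ a₂ b₂ h₂
    cases h₂ with
    | withData _ _ _ _ _ h => exact ih h
  | seq p q s s' s'' a b a' b' _ _ ih ih' =>
    intro s₂ a₂ b₂ h₂
    cases h₂ with
    | seq _ _ _ t' _ _ _ _ _ h h' =>
      obtain ⟨rfl, rfl, rfl⟩ := ih h
      obtain ⟨rfl, rfl, rfl⟩ := ih' h'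
      exact ⟨rfl, rfl, rfl⟩
  | iteTrue t p q s s' a b ht _ ih =>
    intro s₂ a₂ b₂ h₂
    cases h₂ with
    | iteTrue _ _ _ _ _ _ _ _ h =>
      obtain ⟨rfl, rfl, rfl⟩ := ih h
      exact ⟨rfl, rfl, rfl⟩
    | iteFalse _ _ _ _ _ _ _ hn _ => exact absurd ht hn
  | iteFalse t p q s s' a b ht _ ih =>
    intro s₂ a₂ b₂ h₂
    cases h₂ with
    | iteTrue _ _ _ _ _ _ _ hn _ => exact absurd hn ht
    | iteFalse _ _ _ _ _ _ _ _ h =>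
      obtain ⟨rfl, rfl, rfl⟩ := ih h
      exact ⟨rfl, rfl, rfl⟩
  | whileTrue t p s s' s'' a b a' b' ht _ _ ih ih' =>
    intro s₂ a₂ b₂ h₂
    cases h₂ with
    | whileTrue _ _ _ _ _ _ _ _ _ _ h h' =>
      obtain ⟨rfl, rfl, rfl⟩ := ih h
      obtain ⟨rfl, rfl, rfl⟩ := ih' h'
      exact ⟨rfl, rfl, rfl⟩
    | whileFalse _ _ _ hn => exact absurd ht hn
  | whileFalse t p s ht =>
    intro s₂ a₂ b₂ h₂
    cases h₂ with
    | whileTrue _ _ _ _ _ _ _ _ _ hn _ _ => exact absurd hn ht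
    | whileFalse _ _ _ _ => exact ⟨rfl, rfl, rfl⟩

/-- The state `s'` arises from `s` by storing the set `B` in the register `d`. -/
structure State.Stores (s : State V σ ρ) (d : ρ) (B : Set V) (s' : State V σ ρ) : Prop where
  data : s'.data = s.data
  self : s'.reg d = B
  ne : ∀ x, x ≠ d → s'.reg x = s.reg x

theorem State.stores_store (s : State V σ ρ) (d : ρ) (B : Set V) : s.Stores d B (s.store d B) :=
  ⟨rfl, by simp [State.store], fun x hx => by simp [State.store, hx]⟩

variable (G) in
/-- The program `p` started in `s` terminates, and the final state and the numbers of operations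
satisfy `Q`. -/
def Runs (p : Prog σ ρ) (s : State V σ ρ) (Q : State V σ ρ → ℕ → ℕ → Prop) : Prop :=
  ∃ s' a b, Exec G p s s' a b ∧ Q s' a b

namespace Runs

variable {p q : Prog σ ρ} {s : State V σ ρ} {Q Q' : State V σ ρ → ℕ → ℕ → Prop}

theorem mono (h : Runs G p s Q) (hQ : ∀ s' a b, Q s' a b → Q' s' a b) : Runs G p s Q' := by
  obtain ⟨s', a, b, h, h'⟩ := h
  exact ⟨s', a, b, h, hQ _ _ _ h'⟩

theorem skip (h : Q s 0 0) : Runs G .skip s Q := ⟨_, _, _, .skip s, h⟩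

theorem setOp {o : SetOp} {dst x y : ρ}
    (h : ∀ s', s.Stores dst (o.eval (s.reg x) (s.reg y)) s' → Q s' 1 0) :
    Runs G (.setOp o dst x y) s Q := ⟨_, _, _, .setOp o dst x y s, h _ (s.stores_store _ _)⟩

theorem copy {dst x : ρ} (h : ∀ s', s.Stores dst (s.reg x) s' → Q s' 1 0) :
    Runs G (.copy dst x) s Q :=
  setOp (by rwa [SetOp.eval, Set.union_self])

theorem stepOp {o : StepOp} {dst x : ρ}
    (h : ∀ s', s.Stores dst (o.eval G (s.reg x)) s' → Q s' 0 1) :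
    Runs G (.stepOp o dst x) s Q := ⟨_, _, _, .stepOp o dst x s, h _ (s.stores_store _ _)⟩

theorem modify {f : σ → σ} (h : ∀ s', s'.data = f s.data → s'.reg = s.reg → Q s' 0 0) :
    Runs G (.modify f) s Q :=
  ⟨_, _, _, .modify f s, h _ rfl rfl⟩

theorem withData {f : σ → Prog σ ρ} (h : Runs G (f s.data) s Q) : Runs G (.withData f) s Q := by
  obtain ⟨s', a, b, h, h'⟩ := h
  exact ⟨s', a, b, .withData _ _ _ _ _ h, h'⟩

theorem seq (h : Runs G p s fun s' a b => Runs G q s' fun s'' a' b' => Q s'' (a + a') (b + b')) :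
    Runs G (.seq p q) s Q := by
  obtain ⟨s', a, b, h, s'', a', b', h', hQ⟩ := h
  exact ⟨s'', _, _, .seq _ _ _ _ _ _ _ _ _ h h', hQ⟩

theorem of_seq (h : Runs G (.seq p q) s Q) :
    Runs G p s fun s' a b => Runs G q s' fun s'' a' b' => Q s'' (a + a') (b + b') := by
  obtain ⟨s'', a, b, h, hQ⟩ := h
  cases h with
  | seq _ _ _ s₁ _ a₁ b₁ a₂ b₂ h₁ h₂ => exact ⟨s₁, a₁, b₁, h₁, s'', a₂, b₂, h₂, hQ⟩

theorem of_skip_seq (h : Runs G (.seq .skip p) s Q) : Runs G p s Q := by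
  obtain ⟨s', a, b, h, h'⟩ := h.of_seq
  cases h
  exact h'.mono fun _ _ _ hQ => by rwa [zero_add, zero_add] at hQ

theorem iteTrue {t : Cond σ ρ} (ht : t.holds s)
    (h : Runs G p s fun s' a b => Q s' (t.cost + a) b) : Runs G (.ite t p q) s Q := by
  obtain ⟨s', a, b, h, h'⟩ := h
  exact ⟨s', _, b, .iteTrue _ _ _ _ _ _ _ ht h, h'⟩

theorem iteFalse {t : Cond σ ρ} (ht : ¬ t.holds s)
    (h : Runs G q s fun s' a b => Q s' (t.cost + a) b) : Runs G (.ite t p q) s Q := by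
  obtain ⟨s', a, b, h, h'⟩ := h
  exact ⟨s', _, b, .iteFalse _ _ _ _ _ _ _ ht h, h'⟩

theorem whileTrue {t : Cond σ ρ} (ht : t.holds s)
    (h : Runs G (.seq p (.while t p)) s fun s' a b => Q s' (t.cost + a) b) :
    Runs G (.while t p) s Q := by
  obtain ⟨s', a, b, h, h'⟩ := h
  cases h with
  | seq _ _ _ s₁ _ a₁ b₁ a₂ b₂ h₁ h₂ =>
    exact ⟨s', _, _, .whileTrue _ _ _ _ _ _ _ _ _ ht h₁ h₂, by rwa [add_assoc]⟩

theorem whileFalse {t : Cond σ ρ} (ht : ¬ t.holds s) (h : Q s t.cost 0) :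
    Runs G (.while t p) s Q := ⟨_, _, _, .whileFalse _ _ _ ht, h⟩

end Runs

/-- The union of a list of registers is added to the register `d`. -/
theorem runs_forEach_union {ι : Type} (d : ρ) (g : ι → ρ) (l : List ι) (hg : ∀ x ∈ l, g x ≠ d)
    (s : State V σ ρ) : Runs G (.forEach l fun x => .setOp .union d d (g x)) s fun s' a b =>
      s.Stores d (s.reg d ∪ {v | ∃ x ∈ l, v ∈ s.reg (g x)}) s' ∧ a = l.length ∧ b = 0 := by
  induction l generalizing s with
  | nil => exact .skip ⟨⟨rfl, by simp, fun _ _ => rfl⟩, rfl, rfl⟩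
  | cons x l ih =>
    refine .seq (.setOp fun s₁ h₁ =>
      (ih (fun y hy => hg y (List.mem_cons_of_mem x hy)) _).mono ?_)
    rintro s' a b ⟨h, rfl, rfl⟩
    refine ⟨⟨h.data.trans h₁.data, ?_, fun y hy => (h.ne y hy).trans (h₁.ne y hy)⟩,
      by simp [add_comm], rfl⟩
    rw [h.self, h₁.self]
    ext v
    simp only [SetOp.eval, Set.mem_union, Set.mem_ofPred_eq, List.mem_cons, or_and_right,
      exists_or, exists_eq_left, or_assoc]
    refine or_congr Iff.rfl (or_congr Iff.rfl (exists_congr fun y => and_congr_right fun hy => ?_))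
    rw [h₁.ne _ (hg y (List.mem_cons_of_mem x hy))]

end Programs

/-! ## The stored sets -/

section Represents

variable {V : Type*} {c : ℕ} {m : Fin c → ℕ} {G : ParityGame V c}

/-- The registers that hold the input and the current ranks. -/
def Reg.Permanent : Reg m → Prop
  | .all => True
  | .prio _ => True
  | .coord _ _ => True
  | .top => True
  | _ => False

/-- The vertices whose rank is a vector with the entry `x` at the odd priority `oddPrio k`. -/
def coordSet (ρ : V → Rank m) (k : Fin (c / 2)) (x : Fin (coordMax m (oddPrio k) + 1)) : Set V :=
  {v | ∃ q : RankVec m, ρ v = q ∧ ofColex q (oddPrio k) = x}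

/-- The state `s` stores the input and the ranks `ρ`. -/
structure Represents (G : ParityGame V c) (ρ : V → Rank m) (s : State V (Data m) (Reg m)) :
    Prop where
  all : s.reg .all = Set.univ
  prio : ∀ i, s.reg (.prio i) = G.prioSet i
  coord : ∀ k x, s.reg (.coord k x) = coordSet ρ k x
  top : s.reg .top = {v | ρ v = ⊤}

theorem Represents.congr {ρ : V → Rank m} {s s' : State V (Data m) (Reg m)}
    (h : Represents G ρ s) (hs : ∀ x : Reg m, x.Permanent → s'.reg x = s.reg x) :
    Represents G ρ s' :=
  ⟨(hs .all trivial).trans h.all, fun i => (hs (.prio i) trivial).trans (h.prio i),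
    fun k x => (hs (.coord k x) trivial).trans (h.coord k x), (hs .top trivial).trans h.top⟩

theorem Reg.Permanent.ne {x d : Reg m} (hx : x.Permanent) (hd : ¬ d.Permanent) : x ≠ d := by
  rintro rfl
  exact hd hx

theorem Represents.stores {ρ : V → Rank m} {s s' : State V (Data m) (Reg m)}
    (h : Represents G ρ s) {d : Reg m} (hd : ¬ d.Permanent) {B : Set V} (hs : s.Stores d B s') :
    Represents G ρ s' :=
  h.congr fun x hx => hs.ne x (hx.ne hd)

/-- The registers other than `d` that are changed by the reconstruction of a set. -/
def Reg.Scratch (x : Reg m) : Prop := x = .acc ∨ x = .aux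

variable (m) in
/-- The number of the stored sets `C^i_x`. -/
def coordCount : ℕ := ∑ k : Fin (c / 2), (coordMax m (oddPrio k) + 1)

theorem div_two_le_coordCount : c / 2 ≤ coordCount m := by
  have := Finset.sum_le_sum (s := Finset.univ) (f := fun _ : Fin (c / 2) => 1)
    (g := fun k => coordMax m (oddPrio k) + 1) fun k _ => by omega
  simpa [coordCount] using this

theorem runs_clear {s : State V (Data m) (Reg m)} {d : Reg m}
    {Q : State V (Data m) (Reg m) → ℕ → ℕ → Prop} (h : ∀ s', s.Stores d ∅ s' → Q s' 1 0) :
    Runs G (clear m d) s Q :=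
  .setOp (by rwa [SetOp.eval, sdiff_self])

/-! ### Reconstruction -/

/-- The vertices whose rank exceeds `q` in the first of the entries in the list in which it differs
from `q`. -/
def gtSet (ρ : V → Rank m) (q : RankVec m) : List (Fin (c / 2)) → Set V
  | [] => ∅
  | k :: l => {v | ∃ x, ofColex q (oddPrio k) < x ∧ v ∈ coordSet ρ k x} ∪
      (coordSet ρ k (ofColex q (oddPrio k)) ∩ gtSet ρ q l)

/-- The vertices whose rank agrees with `q` in the entries in the list. -/
def eqSet (ρ : V → Rank m) (q : RankVec m) (l : List (Fin (c / 2))) : Set V :=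
  {v | ∀ k ∈ l, v ∈ coordSet ρ k (ofColex q (oddPrio k))}

theorem mem_coordSet_iff {ρ : V → Rank m} {v : V} {y : RankVec m} (h : ρ v = y) {k : Fin (c / 2)}
    {x : Fin (coordMax m (oddPrio k) + 1)} : v ∈ coordSet ρ k x ↔ ofColex y (oddPrio k) = x := by
  constructor
  · rintro ⟨q, hq, hx⟩
    rw [h] at hq
    rwa [WithTop.coe_injective hq]
  · exact fun hx => ⟨y, h, hx⟩

/-- The list must be decreasing for the first differing entry in the list to be the most significant
one. -/
theorem mem_gtSet_iff {ρ : V → Rank m} {v : V} {y : RankVec m} (h : ρ v = y) {q : RankVec m}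
    {l : List (Fin (c / 2))} (hl : l.Pairwise (· > ·)) : v ∈ gtSet ρ q l ↔
      ∃ k ∈ l, ofColex q (oddPrio k) < ofColex y (oddPrio k) ∧
        ∀ j ∈ l, k < j → ofColex y (oddPrio j) = ofColex q (oddPrio j) := by
  induction l with
  | nil => simp [gtSet]
  | cons k l ih =>
    rw [List.pairwise_cons] at hl
    simp only [gtSet, Set.mem_union, Set.mem_inter_iff, ih hl.2, Set.mem_ofPred_eq,
      mem_coordSet_iff h]
    constructor
    · rintro (⟨x, hx, rfl⟩ | ⟨hk, j, hj, hlt, heq⟩)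
      · refine ⟨k, List.mem_cons_self, hx, fun j hj hkj => ?_⟩
        rcases List.mem_cons.1 hj with rfl | hj
        · exact absurd hkj (lt_irrefl _)
        · exact absurd hkj (hl.1 j hj).not_gt
      · refine ⟨j, List.mem_cons_of_mem _ hj, hlt, fun i hi hji => ?_⟩
        rcases List.mem_cons.1 hi with rfl | hi
        · exact hk
        · exact heq i hi hji
    · rintro ⟨j, hj, hlt, heq⟩
      rcases List.mem_cons.1 hj with rfl | hj
      · exact Or.inl ⟨_, hlt, rfl⟩
      · exact Or.inr ⟨heq k List.mem_cons_self (hl.1 j hj), j, hj, hlt,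
          fun i hi => heq i (List.mem_cons_of_mem _ hi)⟩

theorem eq_oddPrio_of_odd {i : Fin c} (hi : Odd i.val) : ∃ k : Fin (c / 2), i = oddPrio k := by
  obtain ⟨t, ht⟩ := hi
  have := i.isLt
  exact ⟨⟨t, by omega⟩, Fin.ext ht⟩

theorem odd_oddPrio (k : Fin (c / 2)) : Odd (oddPrio k).val := ⟨k.val, rfl⟩

theorem oddPrio_lt_iff {j k : Fin (c / 2)} : oddPrio j < oddPrio k ↔ j < k := by
  rw [Fin.lt_def, Fin.lt_def]
  simp only [oddPrio]
  omega

theorem oddPrio_injective : Function.Injective (oddPrio (c := c)) := by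
  intro j k h
  have := congrArg Fin.val h
  simp only [oddPrio] at this
  exact Fin.ext (by omega)

theorem subsingleton_coord {i : Fin c} (hi : ¬ Odd i.val) (x y : Fin (coordMax m i + 1)) :
    x = y := by
  have hm : coordMax m i = 0 := if_neg hi
  exact Fin.ext (by omega)

/-- The order of the vectors in terms of the odd priorities. -/
theorem le_iff_odd {q y : RankVec m} : q ≤ y ↔
    (∃ k : Fin (c / 2), ofColex q (oddPrio k) < ofColex y (oddPrio k) ∧
      ∀ j, k < j → ofColex y (oddPrio j) = ofColex q (oddPrio j)) ∨
    ∀ k : Fin (c / 2), ofColex y (oddPrio k) = ofColex q (oddPrio k) := by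
  rw [le_iff_lt_or_eq]
  refine or_congr ⟨?_, ?_⟩ ⟨?_, ?_⟩
  · intro h
    obtain ⟨i, hi, hlt⟩ := colex_lt_iff.1 h
    have hodd : Odd i.val := by
      by_contra hodd
      exact hlt.ne (subsingleton_coord hodd _ _)
    obtain ⟨k, rfl⟩ := eq_oddPrio_of_odd hodd
    exact ⟨k, hlt, fun j hj => (hi _ (oddPrio_lt_iff.2 hj)).symm⟩
  · rintro ⟨k, hlt, hk⟩
    refine colex_lt_iff.2 ⟨oddPrio k, fun j hj => ?_, hlt⟩
    by_cases hodd : Odd j.val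
    · obtain ⟨j, rfl⟩ := eq_oddPrio_of_odd hodd
      exact (hk j (oddPrio_lt_iff.1 hj)).symm
    · exact subsingleton_coord hodd _ _
  · rintro rfl k
    rfl
  · intro h
    refine ofColex.injective (funext fun i => ?_)
    by_cases hodd : Odd i.val
    · obtain ⟨i, rfl⟩ := eq_oddPrio_of_odd hodd
      exact (h i).symm
    · exact subsingleton_coord hodd _ _

/-- Entries at even priorities are always `0`, so a vector is compared with `q` through its odd
entries alone. -/
theorem reconstruct_eq (ρ : V → Rank m) (q : RankVec m) :
    {v | ρ v = ⊤} ∪ gtSet ρ q (List.finRange (c / 2)).reverse ∪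
      eqSet ρ q (List.finRange (c / 2)).reverse = {v | (q : Rank m) ≤ ρ v} := by
  have hl : (List.finRange (c / 2)).reverse.Pairwise (· > ·) :=
    List.pairwise_reverse.2 (List.pairwise_lt_finRange _)
  ext v
  by_cases h : ρ v = ⊤
  · simp [h]
  · obtain ⟨y, hy⟩ := WithTop.ne_top_iff_exists.1 h
    have hy := hy.symm
    simp only [Set.mem_union, Set.mem_ofPred_eq, h, false_or, mem_gtSet_iff hy hl, eqSet,
      mem_coordSet_iff hy, List.mem_reverse, List.mem_finRange, true_and,
      forall_const]
    rw [hy, WithTop.coe_le_coe, le_iff_odd]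

/-- The result is relative to an arbitrary initial `acc`: the rest of the loop sees only the
vertices that have agreed with `q` so far. This makes the induction on the list work. -/
theorem runs_reconstruct_loop {ρ : V → Rank m} (q : RankVec m) {d : Reg m} (hd : ¬ d.Permanent)
    (hd' : ¬ d.Scratch) (l : List (Fin (c / 2))) {s : State V (Data m) (Reg m)}
    (h : Represents G ρ s) :
    Runs G (.forEach l fun k =>
        .block [
          clear m .aux,
          .forEach ((List.finRange (coordMax m (oddPrio k) + 1)).filter
              fun x => ofColex q (oddPrio k) < x) fun x =>
            .setOp .union .aux .aux (.coord k x),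
          .setOp .inter .aux .acc .aux,
          .setOp .union d d .aux,
          .setOp .inter .acc .acc (.coord k (ofColex q (oddPrio k)))]) s fun s' a b =>
      a ≤ (l.map fun k => 4 * (coordMax m (oddPrio k) + 1)).sum ∧ b = 0 ∧ s'.data = s.data ∧
      (∀ x, x ≠ d → ¬ x.Scratch → s'.reg x = s.reg x) ∧
      s'.reg d = s.reg d ∪ (s.reg .acc ∩ gtSet ρ q l) ∧
      s'.reg .acc = s.reg .acc ∩ eqSet ρ q l := by
  induction l generalizing s with
  | nil => exact .skip (by simp [gtSet, eqSet])
  | cons k l ih =>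
    have hda : d ≠ .acc := fun h => hd' (Or.inl h)
    have hdx : d ≠ .aux := fun h => hd' (Or.inr h)
    refine .seq (.seq (runs_clear fun s₁ h₁ =>
      .seq ((runs_forEach_union _ _ _ (by simp) _).mono ?_)))
    rintro s₂ a b ⟨h₂, rfl, rfl⟩
    refine .seq (.setOp fun s₃ h₃ => .seq (.setOp fun s₄ h₄ => .seq (.setOp fun s₅ h₅ => .skip ?_)))
    have hne : ∀ x, x ≠ d → ¬ x.Scratch → s₅.reg x = s.reg x := fun x hx hx' => by
      have hxa : x ≠ .acc := fun h => hx' (Or.inl h)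
      have hxx : x ≠ .aux := fun h => hx' (Or.inr h)
      rw [h₅.ne _ hxa, h₄.ne _ hx, h₃.ne _ hxx, h₂.ne _ hxx, h₁.ne _ hxx]
    have hr : Represents G ρ s₅ := h.congr fun x hx => hne x (hx.ne hd) (by
      rintro (rfl | rfl) <;> exact hx)
    have haux : s₃.reg .aux =
        s.reg .acc ∩ {v | ∃ x, ofColex q (oddPrio k) < x ∧ v ∈ coordSet ρ k x} := by
      rw [h₃.self, h₂.self, h₂.ne _ (by simp), h₁.ne _ (by simp), h₁.self]
      ext v
      simp only [SetOp.eval, Set.empty_union, Set.mem_inter_iff, Set.mem_ofPred_eq,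
        List.mem_filter, List.mem_finRange, true_and, decide_eq_true_eq]
      refine and_congr_right fun _ => exists_congr fun x => and_congr_right fun _ => ?_
      rw [h₁.ne _ (by simp), h.coord]
    have hacc : s₅.reg .acc = s.reg .acc ∩ coordSet ρ k (ofColex q (oddPrio k)) := by
      rw [h₅.self, h₄.ne _ hda.symm, h₃.ne _ (by simp), h₂.ne _ (by simp), h₁.ne _ (by simp),
        h₄.ne _ (Reg.Permanent.ne (x := .coord _ _) trivial hd), h₃.ne _ (by simp),
        h₂.ne _ (by simp), h₁.ne _ (by simp), h.coord, SetOp.eval]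
    have hdst : s₅.reg d = s.reg d ∪
        (s.reg .acc ∩ {v | ∃ x, ofColex q (oddPrio k) < x ∧ v ∈ coordSet ρ k x}) := by
      rw [h₅.ne _ hda, h₄.self, haux, h₃.ne _ hdx, h₂.ne _ hdx, h₁.ne _ hdx, SetOp.eval]
    refine (ih hr).mono ?_
    rintro s' a b ⟨ha, rfl, hdata, hreg, h1, h2⟩
    refine ⟨?_, by simp, ?_, ?_, ?_, ?_⟩
    -- The value `0` never passes the filter, so there are at most `n_i` unions; with the four other
    -- operations this is at most `4 (n_i + 1)`, also when `n_i = 0`.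
    · have h0 : ((List.finRange (coordMax m (oddPrio k) + 1)).filter
          fun x => ofColex q (oddPrio k) < x).length < coordMax m (oddPrio k) + 1 := by
        refine lt_of_lt_of_le (List.length_filter_lt_length_iff_exists.2 ⟨0, by simp, by simp⟩)
          (by simp)
      simp only [List.map_cons, List.sum_cons]
      omega
    · rw [hdata, h₅.data, h₄.data, h₃.data, h₂.data, h₁.data]
    · intro x hxd hx
      rw [hreg x hxd hx, hne x hxd hx]
    · rw [h1, hdst, hacc, gtSet, Set.inter_union_distrib_left, Set.union_assoc, Set.inter_assoc]
    · rw [h2, hacc, Set.inter_assoc]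
      congr 1
      ext v
      simp [eqSet]

variable (m) in
/-- A bound for the number of operations of a reconstruction. -/
def reconstructCost : ℕ := 3 + 4 * coordCount m

theorem runs_reconstruct {ρ : V → Rank m} (q : Rank m) {d : Reg m} (hd : ¬ d.Permanent)
    (hd' : ¬ d.Scratch) {s : State V (Data m) (Reg m)} (h : Represents G ρ s) :
    Runs G (reconstruct m q d) s fun s' a b =>
      a ≤ reconstructCost m ∧ b = 0 ∧ s'.data = s.data ∧
      (∀ x, x ≠ d → ¬ x.Scratch → s'.reg x = s.reg x) ∧ s'.reg d = {v | q ≤ ρ v} := by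
  have hda : d ≠ .acc := fun h => hd' (Or.inl h)
  induction q using WithTop.recTopCoe with
  | top =>
    refine .copy fun s₁ h₁ => ⟨by rw [reconstructCost]; omega, rfl, h₁.data,
      fun x hx _ => h₁.ne x hx, ?_⟩
    rw [h₁.self, h.top]
    simp
  | coe q =>
    refine .seq (.copy fun s₁ h₁ => .seq (.copy fun s₂ h₂ => .seq ((runs_reconstruct_loop q hd hd' _
      ((h.stores hd h₁).stores (d := .acc) (fun h => h) h₂)).mono ?_)))
    rintro s' a b ⟨ha, rfl, hdata, hreg, h1, h2⟩
    refine .seq (.setOp fun s₃ h₃ => .skip ⟨?_, by simp, ?_, ?_, ?_⟩)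
    · have : ((List.finRange (c / 2)).reverse.map
          fun k => 4 * (coordMax m (oddPrio k) + 1)).sum = 4 * coordCount m := by
        rw [List.map_reverse, List.sum_reverse, coordCount, Finset.mul_sum, ← List.ofFn_eq_map,
          List.sum_ofFn]
      rw [reconstructCost]
      omega
    · rw [h₃.data, hdata, h₂.data, h₁.data]
    · intro x hxd hx
      rw [h₃.ne _ hxd, hreg x hxd hx, h₂.ne _ fun h => hx (Or.inl h), h₁.ne _ hxd]
    · rw [h₃.self, SetOp.eval, h1, h2, h₂.ne _ hda, h₂.self, h₁.self,
        h₁.ne _ (Reg.Permanent.ne (x := .all) trivial hd), h.all, h.top, Set.univ_inter,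
        Set.univ_inter, reconstruct_eq]

end Represents

/-! ## The parts of the algorithm -/

section Changes

variable {V : Type*} {c : ℕ} {σ ρ : Type} {G : ParityGame V c}

/-- The contents `B` of each register `y` in `A` is replaced by `F y B`. -/
structure Changes (A : Set ρ) (F : ρ → Set V → Set V) (s s' : State V σ ρ) : Prop where
  data : s'.data = s.data
  mem : ∀ y ∈ A, s'.reg y = F y (s.reg y)
  notMem : ∀ y ∉ A, s'.reg y = s.reg y

theorem State.Stores.changes {s s' : State V σ ρ} {d : ρ} {B : Set V} (h : s.Stores d B s')
    {F : ρ → Set V → Set V} (hF : F d (s.reg d) = B) : Changes {d} F s s' :=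
  ⟨h.data, fun y hy => by rw [Set.mem_singleton_iff.1 hy, h.self, hF], fun y hy => h.ne y hy⟩

/-- Idempotence of `F` makes repeated or overlapping updates harmless. The register `e`, whose
contents the loop bodies may use as an operand, is never overwritten. -/
theorem runs_forEach_changes {ι : Type} {e : ρ} {E : Set V} {F : ρ → Set V → Set V}
    (hF : ∀ y B, F y (F y B) = F y B) {A : ι → Set ρ} {n : ι → ℕ} {p : ι → Prog σ ρ}
    (hA : ∀ i, e ∉ A i)
    (hp : ∀ i, ∀ s : State V σ ρ, s.reg e = E →
      Runs G (p i) s fun s' a b => Changes (A i) F s s' ∧ a ≤ n i ∧ b = 0)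
    (l : List ι) (s : State V σ ρ) (hs : s.reg e = E) :
    Runs G (.forEach l p) s fun s' a b =>
      Changes {y | ∃ i ∈ l, y ∈ A i} F s s' ∧ a ≤ (l.map n).sum ∧ b = 0 := by
  induction l generalizing s with
  | nil => exact .skip ⟨⟨rfl, by simp, fun _ _ => rfl⟩, by simp, rfl⟩
  | cons i l ih =>
    refine .seq ((hp i s hs).mono ?_)
    rintro s₁ a₁ b₁ ⟨h₁, ha₁, rfl⟩
    refine (ih s₁ (by rw [h₁.notMem e (hA i), hs])).mono ?_
    rintro s₂ a₂ b₂ ⟨h₂, ha₂, rfl⟩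
    refine ⟨⟨h₂.data.trans h₁.data, ?_, ?_⟩,
      by simp only [List.map_cons, List.sum_cons]; omega, rfl⟩
    · rintro y ⟨j, hj, hy⟩
      by_cases h2 : ∃ j ∈ l, y ∈ A j
      · rw [h₂.mem y h2]
        by_cases h1 : y ∈ A i
        · rw [h₁.mem y h1, hF]
        · rw [h₁.notMem y h1]
      · rw [h₂.notMem y h2]
        rcases List.mem_cons.1 hj with rfl | hj
        · exact h₁.mem y hy
        · exact absurd ⟨j, hj, hy⟩ h2
    · intro y hy
      rw [h₂.notMem y fun ⟨j, hj, h⟩ => hy ⟨j, List.mem_cons_of_mem _ hj, h⟩,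
        h₁.notMem y fun h => hy ⟨i, List.mem_cons_self, h⟩]

end Changes

section Parts

variable {V : Type*} {c : ℕ} {m : Fin c → ℕ} {G : ParityGame V c}

theorem coordSet_zeroRank (k : Fin (c / 2)) (x : Fin (coordMax m (oddPrio k) + 1)) :
    coordSet (fun _ : V => zeroRank m) k x = if x = 0 then Set.univ else ∅ := by
  ext v
  refine (mem_coordSet_iff (y := zeroVec m) rfl).trans ?_
  change 0 = x ↔ _
  split_ifs with h
  · simp [h]
  · simpa using fun h' : 0 = x => h h'.symm

theorem runs_initialise {s : State V (Data m) (Reg m)} (h : HoldsInput m G s) :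
    Runs G (initialise m) s fun s' a b =>
      Represents G (fun _ => zeroRank m) s' ∧ a ≤ 1 + coordCount m ∧ b = 0 := by
  refine .seq (runs_clear fun s₁ h₁ => .seq ?_)
  let F : Reg m → Set V → Set V := fun y B => match y with
    | .coord _ x => if x = 0 then Set.univ else ∅
    | _ => B
  have hF : ∀ y B, F y (F y B) = F y B := fun y B => by cases y <;> rfl
  have hloop := runs_forEach_changes (σ := Data m) (G := G) (e := Reg.all) (E := Set.univ)
    (F := F) hF
    (A := fun k : Fin (c / 2) => {y | ∃ x ∈ List.finRange (coordMax m (oddPrio k) + 1),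
      y ∈ ({.coord k x} : Set (Reg m))})
    (n := fun k => coordMax m (oddPrio k) + 1)
    (p := fun k => .forEach (List.finRange (coordMax m (oddPrio k) + 1)) fun x =>
        if x = 0 then .copy (.coord k x) .all else clear m (.coord k x))
    (by simp) (fun k s hs => by
      refine (runs_forEach_changes hF (A := fun x => {.coord k x}) (n := fun _ => 1) (e := Reg.all)
        (by simp) (fun x s hs => ?_) _ s hs).mono (by simp)
      by_cases hx : x = 0
      · rw [if_pos hx]
        exact .copy fun s' h' => ⟨h'.changes (by simp only [F]; rw [if_pos hx, hs]), le_rfl, rfl⟩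
      · rw [if_neg hx]
        exact runs_clear fun s' h' => ⟨h'.changes (by simp only [F]; rw [if_neg hx]), le_rfl, rfl⟩)
    (List.finRange (c / 2)) s₁ (by rw [h₁.ne _ (by simp), h.1])
  refine hloop.mono ?_
  rintro s₂ a b ⟨h₂, ha, rfl⟩
  refine .skip ⟨⟨?_, fun i => ?_, fun k x => ?_, ?_⟩, ?_, rfl⟩
  · rw [h₂.notMem _ (by simp), h₁.ne _ (by simp), h.1]
  · rw [h₂.notMem _ (by simp), h₁.ne _ (by simp), h.2]
  · rw [h₂.mem _ ⟨k, by simp, x, by simp, rfl⟩, coordSet_zeroRank]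
  · rw [h₂.notMem _ (by simp), h₁.self]
    simp [zeroRank]
  · rw [← List.ofFn_eq_map, List.sum_ofFn] at ha
    rw [coordCount]
    omega

/-! ### The updated set -/

theorem runs_addOdd {ρ : V → Rank m} {s : State V (Data m) (Reg m)} (h : Represents G ρ s)
    (r : Rank m) (k : Fin (c / 2)) : Runs G (addOdd m r k) s fun s' a b =>
      a ≤ reconstructCost m + 2 ∧ b = 1 ∧ s'.data = s.data ∧
      (∀ x, x ≠ .work → x ≠ .new → ¬ x.Scratch → s'.reg x = s.reg x) ∧
      s'.reg .new = s.reg .new ∪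
        {v | G.prio v = oddPrio k ∧ v ∈ G.cpre .odd {w | decrAt (oddPrio k).val r ≤ ρ w}} := by
  refine .seq ((runs_reconstruct _ (d := .work) (fun h => h) (by simp [Reg.Scratch]) h).mono ?_)
  rintro s₁ a b ⟨ha, rfl, hdata, hreg, hwork⟩
  refine .seq (.stepOp fun s₂ h₂ => .seq (.setOp fun s₃ h₃ => .seq (.setOp fun s₄ h₄ => .skip
    ⟨by omega, rfl, ?_, fun x hw hn hx => ?_, ?_⟩)))
  · rw [h₄.data, h₃.data, h₂.data, hdata]
  · rw [h₄.ne _ hn, h₃.ne _ hw, h₂.ne _ hw, hreg _ hw hx]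
  · rw [h₄.self, h₃.self, h₃.ne _ (by simp), h₂.self, h₂.ne _ (by simp), h₂.ne _ (by simp),
      hreg .new (by simp) (by simp [Reg.Scratch]),
      hreg (.prio _) (by simp) (by simp [Reg.Scratch]), hwork,
      h.prio]
    simp only [SetOp.eval, StepOp.eval]
    congr 1
    ext v
    exact and_comm

theorem runs_addOdds {ρ : V → Rank m} (r : Rank m) (l : List (Fin (c / 2)))
    {s : State V (Data m) (Reg m)} (h : Represents G ρ s) :
    Runs G (.forEach l (addOdd m r)) s fun s' a b =>
      a ≤ l.length * (reconstructCost m + 2) ∧ b = l.length ∧ s'.data = s.data ∧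
      (∀ x, x ≠ .work → x ≠ .new → ¬ x.Scratch → s'.reg x = s.reg x) ∧
      s'.reg .new = s.reg .new ∪ {v | ∃ k ∈ l, G.prio v = oddPrio k ∧
        v ∈ G.cpre .odd {w | decrAt (oddPrio k).val r ≤ ρ w}} := by
  induction l generalizing s with
  | nil => exact .skip (by simp)
  | cons k l ih =>
    refine .seq ((runs_addOdd h r k).mono ?_)
    rintro s₁ a₁ b₁ ⟨ha₁, rfl, hdata₁, hreg₁, hnew₁⟩
    refine (ih (h.congr fun x hx => hreg₁ x (hx.ne fun h => h) (hx.ne fun h => h) ?_)).mono ?_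
    · rintro (rfl | rfl) <;> exact hx
    rintro s₂ a₂ b₂ ⟨ha₂, rfl, hdata₂, hreg₂, hnew₂⟩
    refine ⟨?_, by simp [add_comm], hdata₂.trans hdata₁, fun x h1 h2 h3 => ?_, ?_⟩
    · rw [List.length_cons, Nat.succ_mul]
      omega
    · rw [hreg₂ x h1 h2 h3, hreg₁ x h1 h2 h3]
    · rw [hnew₂, hnew₁, Set.union_assoc]
      congr 1
      ext v
      simp [or_and_right, exists_or]

/-- The last two conclusions characterise the result as the least closed set above the start. Each
round but the last adds a vertex, and costs one one-step operation and four basic ones, including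
the comparison. -/
theorem runs_saturate [Finite V] (s : State V (Data m) (Reg m)) :
    Runs G (saturate m) s fun s' a b =>
      a ≤ 4 * b ∧ b ≤ (s'.reg .new \ s.reg .new).ncard + 1 ∧ s'.data = s.data ∧
      (∀ x, x ≠ .prev → x ≠ .work → x ≠ .new → s'.reg x = s.reg x) ∧
      s.reg .new ⊆ s'.reg .new ∧
      G.cpre .odd (s'.reg .new) \ s.reg .excluded ⊆ s'.reg .new ∧
      ∀ X, s.reg .new ⊆ X → G.cpre .odd X \ s.reg .excluded ⊆ X → s'.reg .new ⊆ X := by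
  induction hn : (s.reg .new)ᶜ.ncard using Nat.strong_induction_on generalizing s with
  | _ n ih =>
    refine .seq (.seq (.copy fun s₁ h₁ => .seq (.stepOp fun s₂ h₂ => .seq (.setOp fun s₃ h₃ =>
      .seq (.setOp fun s₄ h₄ => .skip ?_)))))
    have hreg : ∀ x, x ≠ .prev → x ≠ .work → x ≠ .new → s₄.reg x = s.reg x := fun x h1 h2 h3 => by
      rw [h₄.ne _ h3, h₃.ne _ h2, h₂.ne _ h2, h₁.ne _ h1]
    have hdata : s₄.data = s.data := by rw [h₄.data, h₃.data, h₂.data, h₁.data]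
    have hprev : s₄.reg .prev = s.reg .new := by
      rw [h₄.ne _ (by simp), h₃.ne _ (by simp), h₂.ne _ (by simp), h₁.self]
    have hnew : s₄.reg .new = s.reg .new ∪ (G.cpre .odd (s.reg .new) \ s.reg .excluded) := by
      rw [h₄.self, h₃.self, h₃.ne _ (by simp), h₂.self, h₂.ne _ (by simp), h₂.ne _ (by simp),
        h₁.ne _ (by simp), h₁.ne _ (by simp)]
      rfl
    by_cases hfix : s₄.reg .new = s.reg .new
    · refine .whileFalse (fun h => h (by change s₄.reg _ = s₄.reg _; rw [hprev, hfix])) ?_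
      refine ⟨le_rfl, by simp, hdata, hreg, hfix.ge, ?_, fun X hX _ => hfix.le.trans hX⟩
      rw [hfix]
      rw [hnew, Set.union_eq_left] at hfix
      exact hfix
    · refine .whileTrue (fun h => hfix (by rw [← hprev]; exact h)) ?_
      have hsub : s.reg .new ⊆ s₄.reg .new := by
        rw [hnew]
        exact Set.subset_union_left
      have hss : s.reg .new ⊂ s₄.reg .new :=
        ⟨hsub, fun h => hfix (h.antisymm hsub)⟩
      refine (ih _ ?_ s₄ rfl).mono ?_
      · rw [← hn]
        exact Set.ncard_lt_ncard (compl_lt_compl_iff_lt.2 hss)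
      rintro s' a b ⟨ha, hb, hdata', hreg', h1, h2, h3⟩
      rw [hreg .excluded (by simp) (by simp) (by simp)] at h2 h3
      refine ⟨?_, ?_, hdata'.trans hdata, fun x hp hw hx => ?_, hsub.trans h1, h2, fun X hX hcl =>
        h3 X ?_ hcl⟩
      · simp only [Cond.cost]
        omega
      · have : (s'.reg .new \ s₄.reg .new).ncard < (s'.reg .new \ s.reg .new).ncard := by
          obtain ⟨v, hv, hv'⟩ := Set.exists_of_ssubset hss
          exact Set.ncard_lt_ncard ⟨Set.sdiff_subset_sdiff_right hsub,
            fun h => (h ⟨h1 hv, hv'⟩).2 hv⟩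
        omega
      · rw [hreg' x hp hw hx, hreg x hp hw hx]
      · rw [hnew]
        exact Set.union_subset hX
          ((Set.sdiff_subset_sdiff_left (ParityGame.cpre_mono _ hX)).trans hcl)

/-- The closure condition that defines the updated set `S_r`. -/
structure IsClosedAt (G : ParityGame V c) (ρ : V → Rank m) (r : Rank m) (S : Set V) : Prop where
  base : {v | r ≤ ρ v} ⊆ S
  odd : ∀ v, Odd (G.prio v).val → r = proj (G.prio v).val r →
    v ∈ G.cpre .odd {w | decrAt (G.prio v).val r ≤ ρ w} → v ∈ S
  step : ∀ v, r = proj (G.prio v).val r → v ∈ G.cpre .odd S → v ∈ S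

/-- The least set that satisfies the closure condition. -/
structure IsUpdate (G : ParityGame V c) (ρ : V → Rank m) (r : Rank m) (S : Set V) : Prop where
  closed : IsClosedAt G ρ r S
  least : ∀ X, IsClosedAt G ρ r X → S ⊆ X

theorem runs_updateSet [Finite V] {ρ : V → Rank m} {s : State V (Data m) (Reg m)}
    (h : Represents G ρ s) (r : Rank m) (hs : s.reg .new = {v | r ≤ ρ v}) :
    Runs G (updateSet m r) s fun s' a b =>
      a ≤ c / 2 * (reconstructCost m + 2) + c + 1 + 4 * ((s'.reg .new \ s.reg .new).ncard + 1) ∧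
      b ≤ c / 2 + (s'.reg .new \ s.reg .new).ncard + 1 ∧ s'.data = s.data ∧
      (∀ x, x ≠ .work → x ≠ .new → x ≠ .prev → x ≠ .excluded → ¬ x.Scratch →
        s'.reg x = s.reg x) ∧
      IsUpdate G ρ r (s'.reg .new) := by
  classical
  -- One argument for both branches: the lists enter only through the condition that truncation
  -- fixes `r`. For `r = ⊤` it always holds, so all odd priorities are used and none is excluded.
  have main : ∀ (l : List (Fin (c / 2))) (l' : List (Fin c)), l.length ≤ c / 2 → l'.length ≤ c →
      (∀ k, k ∈ l ↔ r = proj (oddPrio k).val r) → (∀ i : Fin c, i ∈ l' ↔ ¬ r = proj i.val r) →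
      Runs G (.block [.forEach l (addOdd m r), clear m .excluded,
        .forEach l' fun i => .setOp .union .excluded .excluded (.prio i), saturate m]) s
        fun s' a b =>
          a ≤ c / 2 * (reconstructCost m + 2) + c + 1 +
            4 * ((s'.reg .new \ s.reg .new).ncard + 1) ∧
          b ≤ c / 2 + (s'.reg .new \ s.reg .new).ncard + 1 ∧ s'.data = s.data ∧
          (∀ x, x ≠ .work → x ≠ .new → x ≠ .prev → x ≠ .excluded → ¬ x.Scratch →
            s'.reg x = s.reg x) ∧
          IsUpdate G ρ r (s'.reg .new) := by
    intro l l' hl hl' hlm hlm'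
    refine .seq ((runs_addOdds r l h).mono ?_)
    rintro s₁ a₁ b₁ ⟨ha₁, rfl, hdata₁, hreg₁, hnew₁⟩
    refine .seq (runs_clear fun s₂ h₂ => .seq ((runs_forEach_union _ _ _ (by simp) _).mono ?_))
    rintro s₃ a₃ b₃ ⟨h₃, rfl, rfl⟩
    refine .seq ((runs_saturate s₃).mono ?_)
    rintro s₄ a₄ b₄ ⟨ha₄, hb₄, hdata₄, hreg₄, h1, h2, h3⟩
    have hexc : s₃.reg .excluded = {v | ¬ r = proj (G.prio v).val r} := by
      rw [h₃.self, h₂.self, Set.empty_union]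
      ext v
      have : ∀ i, s₂.reg (.prio i) = G.prioSet i := fun i => by
        rw [h₂.ne _ (by simp), hreg₁ _ (by simp) (by simp) (by simp [Reg.Scratch]), h.prio]
      simp only [this, hlm', Set.mem_ofPred_eq]
      constructor
      · rintro ⟨i, hi, rfl⟩
        exact hi
      · exact fun hv => ⟨_, hv, rfl⟩
    have hnew : s₃.reg .new = {v | r ≤ ρ v} ∪ {v | ∃ k ∈ l, G.prio v = oddPrio k ∧
        v ∈ G.cpre .odd {w | decrAt (oddPrio k).val r ≤ ρ w}} := by
      rw [h₃.ne _ (by simp), h₂.ne _ (by simp), hnew₁, hs]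
    have hsub : s.reg .new ⊆ s₃.reg .new := by
      rw [hnew, hs]
      exact Set.subset_union_left
    have hcard : (s₄.reg .new \ s₃.reg .new).ncard ≤ (s₄.reg .new \ s.reg .new).ncard :=
      Set.ncard_le_ncard (Set.sdiff_subset_sdiff_right hsub)
    have hmul := Nat.mul_le_mul_right (reconstructCost m + 2) hl
    refine .skip ⟨by omega, by omega, ?_, fun x hw hn hp he hx => ?_, ⟨⟨?_, ?_, ?_⟩, ?_⟩⟩
    · rw [hdata₄, h₃.data, h₂.data, hdata₁]
    · rw [hreg₄ x hp hw hn, h₃.ne _ he, h₂.ne _ he, hreg₁ x hw hn hx]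
    · exact hs ▸ hsub.trans h1
    · intro v hodd hr hv
      obtain ⟨k, hk⟩ := eq_oddPrio_of_odd hodd
      refine h1 ?_
      rw [hnew]
      exact Or.inr ⟨k, (hlm k).2 (hk ▸ hr), hk, hk ▸ hv⟩
    · intro v hr hv
      refine h2 ⟨hv, ?_⟩
      rw [hexc]
      exact fun h => h hr
    · intro X hX
      refine h3 X ?_ ?_
      · rw [hnew]
        refine Set.union_subset hX.base ?_
        rintro v ⟨k, hk, hv, hv'⟩
        exact hX.odd v (hv ▸ odd_oddPrio k) (hv ▸ (hlm k).1 hk) (hv ▸ hv')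
      · rw [hexc]
        rintro v ⟨hv, hv'⟩
        exact hX.step v (not_not.1 hv') hv
  rw [updateSet]
  split_ifs with hr
  · exact main _ _ ((List.length_filter_le _ _).trans (by simp))
      ((List.length_filter_le _ _).trans (by simp)) (fun k => by simp [le_level_iff])
      (fun i => by simp [← le_level_iff])
  · rw [not_not] at hr
    subst hr
    have h := main (List.finRange (c / 2)) [] (by simp) (by simp) (fun k => by simp [proj_top])
      fun i => by simp [proj_top]
    -- The branch for `⊤` has no loop over excluded classes; the empty loop is removed from the
    -- uniform statement.
    exact .seq (h.of_seq.mono fun _ _ _ h => .seq (h.of_seq.mono fun _ _ _ h => h.of_skip_seq))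

end Parts

section NextRank

variable {V : Type*} {c : ℕ} {m : Fin c → ℕ} {G : ParityGame V c}

/-! ### The next rank -/

/-- `q` is the greatest rank below `r` such that all vertices in `S` have rank at least `q`. -/
structure IsFallback (ρ : V → Rank m) (S : Set V) (r q : Rank m) : Prop where
  lt : q < r
  subset : S ⊆ {v | q ≤ ρ v}
  not_subset : ∀ y, q < y → y < r → ¬ S ⊆ {v | y ≤ ρ v}

theorem rankIndex_decr {r : Rank m} (h : zeroRank m < r) :
    rankIndex (decr r) + 1 = rankIndex r := by
  have hlt : decr r < ⊤ := (decr_lt h).trans_le le_top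
  rw [← rankIndex_incr hlt]
  congr 1
  exact le_antisymm (incr_le (decr_lt h)) (not_lt.1 fun h' => (le_decr h').not_gt (lt_incr hlt))

/-- The search stops at `0̄` at the latest, since every vertex has rank at least `0̄`. Each position
passed costs one reconstruction and one inclusion test. -/
theorem runs_searchRank {ρ : V → Rank m} {s : State V (Data m) (Reg m)} (h : Represents G ρ s)
    (hs : ¬ s.reg .new ⊆ {v | s.data.r' ≤ ρ v}) :
    Runs G (.repeatUntil
          (.block [
            .modify fun d => { d with r' := decr d.r' },
            .withData fun d => reconstruct m d.r' .work])
          (.subset .new .work)) s fun s' a b =>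
      ∃ q, IsFallback ρ (s.reg .new) s.data.r' q ∧ s'.data = { s.data with r' := q } ∧ b = 0 ∧
        (∀ x, x ≠ .work → ¬ x.Scratch → s'.reg x = s.reg x) ∧
        a ≤ (reconstructCost m + 1) * (rankIndex s.data.r' - rankIndex q) := by
  induction hn : rankIndex s.data.r' using Nat.strong_induction_on generalizing s with
  | _ n ih =>
    have h0 : zeroRank m < s.data.r' := by
      refine lt_of_le_of_ne (zeroRank_le _) fun h0 => hs ?_
      rw [← h0]
      exact fun v _ => zeroRank_le _
    have hidx := rankIndex_decr h0
    refine .seq (.seq (.modify fun s₀ hdata₀ hreg₀ => .seq (.withData ((runs_reconstruct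
      (d := .work) _ (fun h => h) (by simp [Reg.Scratch])
      (h.congr fun _ _ => by rw [hreg₀])).mono ?_))))
    rintro s₁ a b ⟨ha, rfl, hdata, hreg, hwork⟩
    rw [hdata₀] at hdata hwork
    rw [hreg₀] at hreg
    have hnew : s₁.reg .new = s.reg .new := hreg _ (by simp) (by simp [Reg.Scratch])
    have hr : Represents G ρ s₁ := h.congr fun x hx => hreg x (hx.ne fun h => h) (by
      rintro (rfl | rfl) <;> exact hx)
    refine .skip ?_
    by_cases hsub : s.reg .new ⊆ {v | decr s.data.r' ≤ ρ v}
    · refine .whileFalse (fun hc => hc ?_) ⟨decr s.data.r', ⟨decr_lt h0, hsub,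
        fun y hy hy' => absurd hy (le_decr hy').not_gt⟩, hdata, rfl, hreg, ?_⟩
      · change s₁.reg .new ⊆ s₁.reg .work
        rwa [hnew, hwork]
      · rw [show n - rankIndex (decr s.data.r') = 1 by omega]
        simp only [Cond.cost]
        omega
    · refine .whileTrue (fun hc => hsub ?_)
        ((ih (rankIndex (decr s.data.r')) (by omega) hr ?_ ?_).mono ?_)
      · rw [← hnew, ← hwork]
        exact hc
      · rwa [hnew, hdata]
      · rw [hdata]
      · rintro s' a' b' ⟨q, hq, hdata', rfl, hreg', ha'⟩
        rw [hdata, hnew] at hq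
        have hqi := rankIndex_strictMono hq.lt
        rw [hdata] at hdata'
        refine ⟨q, ⟨hq.lt.trans (decr_lt h0), hq.subset, fun y hy hy' => ?_⟩, hdata', rfl,
          fun x h1 h2 => (hreg' x h1 h2).trans (hreg x h1 h2), ?_⟩
        · rcases (le_decr hy').lt_or_eq with hlt | rfl
          · exact hq.not_subset y hy hlt
          · exact hsub
        · dsimp only at hqi
          rw [show n - rankIndex q = (rankIndex (decr s.data.r') - rankIndex q) + 1 by omega,
            Nat.mul_succ]
          simp only [Cond.cost]
          omega

/-- Both branches determine the same kind of rank `q`; the first finds it at once. The search uses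
the ranks before the update, since the new ones are stored only afterwards. -/
theorem runs_updateRank {ρ : V → Rank m} {s : State V (Data m) (Reg m)} (h : Represents G ρ s)
    (h0 : zeroRank m < s.data.r) : Runs G (updateRank m) s fun s' a b =>
      ∃ q, IsFallback ρ (s.reg .new) s.data.r q ∧ b = 0 ∧
        (∀ x, x ≠ .work → ¬ x.Scratch → s'.reg x = s.reg x) ∧
        a ≤ (reconstructCost m + 1) * (rankIndex s.data.r - rankIndex q) ∧
        (q = decr s.data.r → s.data.r = ⊤ → s'.data.done = true) ∧
        (q = decr s.data.r → s.data.r ≠ ⊤ →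
          s'.data.done = s.data.done ∧ s'.data.r = incr s.data.r) ∧
        (q ≠ decr s.data.r → s'.data.done = s.data.done ∧ s'.data.r = incr q) := by
  have hidx := rankIndex_decr h0
  refine .seq (.modify fun s₀ hdata₀ hreg₀ => .seq (.withData ((runs_reconstruct (d := .work)
    _ (fun h => h) (by simp [Reg.Scratch]) (h.congr fun _ _ => by rw [hreg₀])).mono ?_)))
  rintro s₁ a b ⟨ha, rfl, hdata, hreg, hwork⟩
  rw [hdata₀] at hdata hwork
  rw [hreg₀] at hreg
  have hnew : s₁.reg .new = s.reg .new := hreg _ (by simp) (by simp [Reg.Scratch])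
  have hr : Represents G ρ s₁ := h.congr fun x hx => hreg x (hx.ne fun h => h) (by
    rintro (rfl | rfl) <;> exact hx)
  refine .seq ?_
  by_cases hsub : s.reg .new ⊆ {v | decr s.data.r ≤ ρ v}
  · have hq : IsFallback ρ (s.reg .new) s.data.r (decr s.data.r) :=
      ⟨decr_lt h0, hsub, fun y hy hy' => absurd hy (le_decr hy').not_gt⟩
    have hcost : 0 + (a + (1 + 0 + 0)) ≤
        (reconstructCost m + 1) * (rankIndex s.data.r - rankIndex (decr s.data.r)) := by
      rw [show rankIndex s.data.r - rankIndex (decr s.data.r) = 1 by omega]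
      omega
    refine .iteTrue ?_ ?_
    · change s₁.reg .new ⊆ s₁.reg .work
      rwa [hnew, hwork]
    by_cases htop : s.data.r = ⊤
    · refine .iteFalse ?_ (.modify fun s₂ hdata₂ hreg₂ => .skip ⟨_, hq, rfl, ?_, hcost,
        fun _ _ => by rw [hdata₂], fun _ h => absurd htop h, fun h => absurd rfl h⟩)
      · change ¬ s₁.data.r < ⊤
        rw [hdata]
        simp [htop]
      · rwa [hreg₂]
    · refine .iteTrue ?_ (.modify fun s₂ hdata₂ hreg₂ => .skip ⟨_, hq, rfl, ?_, hcost,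
        fun _ h => absurd h htop, fun _ _ => by rw [hdata₂, hdata]; exact ⟨rfl, rfl⟩,
        fun h => absurd rfl h⟩)
      · change s₁.data.r < ⊤
        rw [hdata]
        exact lt_top_iff_ne_top.2 htop
      · rwa [hreg₂]
  · refine .iteFalse ?_ ?_
    · change ¬ s₁.reg .new ⊆ s₁.reg .work
      rwa [hnew, hwork]
    refine .seq ((runs_searchRank hr (by rwa [hnew, hdata])).mono ?_)
    rintro s₂ a₂ b₂ ⟨q, hq, hdata₂, rfl, hreg₂, ha₂⟩
    rw [hdata, hnew] at hq
    rw [hdata] at hdata₂ ha₂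
    dsimp only at hq ha₂
    have hqi := rankIndex_strictMono hq.lt
    refine .seq (.modify fun s₃ hdata₃ hreg₃ => .skip (.skip ⟨q, ⟨hq.lt.trans (decr_lt h0),
      hq.subset, fun y hy hy' => ?_⟩, rfl, fun x h1 h2 => ?_, ?_, fun h => absurd h hq.lt.ne,
      fun h => absurd h hq.lt.ne, fun _ => ?_⟩))
    · rcases (le_decr hy').lt_or_eq with hlt | rfl
      · exact hq.not_subset y hy hlt
      · exact hsub
    · rw [hreg₃, hreg₂ x h1 h2, hreg x h1 h2]
    · rw [show rankIndex s.data.r - rankIndex q =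
        (rankIndex (decr s.data.r) - rankIndex q) + 1 by omega, Nat.mul_succ]
      simp only [Cond.cost]
      omega
    · rw [hdata₃, hdata₂]
      exact ⟨rfl, rfl⟩

/-! ### Storing the result -/

open Classical in
/-- The ranks after the vertices in `D` have received the rank `r`. -/
noncomputable def assign (ρ : V → Rank m) (D : Set V) (r : Rank m) (v : V) : Rank m :=
  if v ∈ D then r else ρ v

theorem coordSet_assign_top (ρ : V → Rank m) (D : Set V) (k : Fin (c / 2))
    (x : Fin (coordMax m (oddPrio k) + 1)) :
    coordSet (assign ρ D ⊤) k x = coordSet ρ k x \ D := by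
  ext v
  by_cases hv : v ∈ D <;> simp [coordSet, assign, hv]

theorem coordSet_assign_coe (ρ : V → Rank m) (D : Set V) (r : RankVec m) (k : Fin (c / 2))
    (x : Fin (coordMax m (oddPrio k) + 1)) : coordSet (assign ρ D r) k x =
      if ofColex r (oddPrio k) = x then (coordSet ρ k x \ D) ∪ D else coordSet ρ k x \ D := by
  ext v
  by_cases hv : v ∈ D
  · have : assign ρ D r v = r := if_pos hv
    rw [mem_coordSet_iff this]
    split_ifs with h
    · simp [h, hv]
    · simpa [hv] using h
  · split_ifs <;> simp [coordSet, assign, hv]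

theorem runs_storeSet {ρ : V → Rank m} {s : State V (Data m) (Reg m)} (h : Represents G ρ s)
    {r : Rank m} (hold : s.reg .old = {v | r ≤ ρ v}) : Runs G (storeSet m r) s fun s' a b =>
      Represents G (assign ρ (s.reg .new \ s.reg .old) r) s' ∧ s'.data = s.data ∧
        a ≤ 2 + 2 * coordCount m ∧ b = 0 := by
  refine .seq (.setOp fun s₁ h₁ => ?_)
  set D := s.reg .new \ s.reg .old with hD
  have haux : s₁.reg .aux = D := h₁.self
  have hr₁ : Represents G ρ s₁ := h.stores (d := .aux) (fun h => h) h₁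
  have hdiff := runs_forEach_changes (σ := Data m) (G := G) (e := Reg.aux) (E := D)
    (F := fun _ B => B \ D) (by simp)
    (A := fun k : Fin (c / 2) => {y | ∃ x ∈ List.finRange (coordMax m (oddPrio k) + 1),
      y ∈ ({.coord k x} : Set (Reg m))})
    (n := fun k => coordMax m (oddPrio k) + 1)
    (p := fun k => .forEach (List.finRange (coordMax m (oddPrio k) + 1)) fun x =>
        .setOp .diff (.coord k x) (.coord k x) .aux)
    (by simp) (fun k s hs => by
      refine (runs_forEach_changes (F := fun _ B => B \ D) (by simp) (A := fun x => {.coord k x})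
        (n := fun _ => 1) (e := Reg.aux) (by simp) (fun x s hs => ?_) _ s hs).mono (by simp)
      exact .setOp fun s' h' => ⟨h'.changes (by rw [hs]; rfl), le_rfl, rfl⟩)
    (List.finRange (c / 2)) s₁ haux
  refine .seq (hdiff.mono ?_)
  rintro s₂ a b ⟨h₂, ha, rfl⟩
  have hcoord : ∀ k x, s₂.reg (.coord k x) = coordSet ρ k x \ D := fun k x => by
    rw [h₂.mem _ ⟨k, by simp, x, by simp, rfl⟩, hr₁.coord]
  have hne : ∀ y, (∀ k x, y ≠ .coord k x) → s₂.reg y = s₁.reg y := fun y hy =>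
    h₂.notMem y (by rintro ⟨k, -, x, -, h⟩; exact hy k x h)
  rw [← List.ofFn_eq_map, List.sum_ofFn] at ha
  have hcost : a ≤ coordCount m := ha
  have hk := div_two_le_coordCount (m := m)
  induction r using WithTop.recTopCoe with
  | top =>
    refine .seq (.setOp fun s₃ h₃ =>
      .skip ⟨⟨?_, fun i => ?_, fun k x => ?_, ?_⟩, ?_, by omega, rfl⟩)
    · rw [h₃.ne _ (by simp), hne _ (by simp), hr₁.all]
    · rw [h₃.ne _ (by simp), hne _ (by simp), hr₁.prio]
    · rw [h₃.ne _ (by simp), hcoord, coordSet_assign_top]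
    · rw [h₃.self, hne _ (by simp), hne _ (by simp), haux, hr₁.top]
      ext v
      by_cases hv : v ∈ D <;> simp [SetOp.eval, assign, hv]
    · rw [h₃.data, h₂.data, h₁.data]
  | coe r =>
    have hunion := runs_forEach_changes (σ := Data m) (G := G) (e := Reg.aux) (E := D)
      (F := fun _ B => B ∪ D) (by simp)
      (A := fun k : Fin (c / 2) => ({.coord k (ofColex r (oddPrio k))} : Set (Reg m)))
      (n := fun _ => 1)
      (p := fun k => .setOp .union (.coord k (ofColex r (oddPrio k)))
        (.coord k (ofColex r (oddPrio k))) .aux)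
      (by simp) (fun k s hs =>
        .setOp fun s' h' => ⟨h'.changes (by rw [hs]; rfl), le_rfl, rfl⟩)
      (List.finRange (c / 2)) s₂ (by rw [hne _ (by simp), haux])
    refine .seq (hunion.mono ?_)
    rintro s₃ a₃ b₃ ⟨h₃, ha₃, rfl⟩
    have hne₃ : ∀ y, (∀ k x, y ≠ .coord k x) → s₃.reg y = s₁.reg y := fun y hy =>
      (h₃.notMem y (by rintro ⟨k, -, h⟩; exact hy k _ h)).trans (hne y hy)
    refine .skip ⟨⟨?_, fun i => ?_, fun k x => ?_, ?_⟩, ?_, ?_, rfl⟩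
    · rw [hne₃ _ (by simp), hr₁.all]
    · rw [hne₃ _ (by simp), hr₁.prio]
    · rw [coordSet_assign_coe]
      split_ifs with hx
      · rw [h₃.mem _ ⟨k, by simp, by rw [hx]; rfl⟩, hcoord]
      · rw [h₃.notMem _ (by
          rintro ⟨j, -, h⟩
          cases Set.mem_singleton_iff.1 h
          exact hx rfl), hcoord]
    · rw [hne₃ _ (by simp), hr₁.top]
      ext v
      by_cases hv : v ∈ D
      -- A vertex of `D` had rank below `r`, hence not `⊤`, so `S_⊤` is correctly left untouched.
      · have hv' : ¬ (r : Rank m) ≤ ρ v := by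
          have := hv.2
          rwa [hold] at this
        have : ρ v ≠ ⊤ := fun h => hv' (h ▸ le_top)
        simp [assign, hv, this]
      · simp [assign, hv]
    · rw [h₃.data, h₂.data, h₁.data]
    · simp at ha₃
      omega

end NextRank

/-! ## Correctness and running time of the main loop -/

section MainLoop

variable {V : Type*} {c : ℕ} {m : Fin c → ℕ} {G : ParityGame V c}

/-- The condition of a progress measure holds for all ranks below `r`. -/
def ClosedBelow (G : ParityGame V c) (ρ : V → Rank m) (r : Rank m) : Prop :=
  ∀ v q, q < r → q = proj (G.prio v).val q →
    v ∈ G.cpre .odd {w | q ≤ incrAt (G.prio v).val (ρ w)} → q ≤ ρ v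

theorem assign_of_mem {ρ : V → Rank m} {D : Set V} {r : Rank m} {v : V} (h : v ∈ D) :
    assign ρ D r v = r := if_pos h

theorem assign_of_notMem {ρ : V → Rank m} {D : Set V} {r : Rank m} {v : V} (h : v ∉ D) :
    assign ρ D r v = ρ v := if_neg h

theorem le_assign {ρ : V → Rank m} {S : Set V} {r : Rank m} (v : V) :
    ρ v ≤ assign ρ (S \ {v | r ≤ ρ v}) r v := by
  by_cases h : v ∈ S \ {v | r ≤ ρ v}
  · rw [assign_of_mem h]
    exact (not_le.1 h.2).le
  · rw [assign_of_notMem h]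

/-- The set of vertices to which `ρ'` gives rank at least `r` is itself closed at `r`, so it
contains the least closed set `S`. -/
theorem IsUpdate.le_of_isProgress {ρ : V → Rank m} {r : Rank m} {S : Set V}
    (h : IsUpdate G ρ r S) (h0 : zeroRank m < r) {ρ' : V → Rank m} (hρ' : G.IsProgress ρ')
    (hle : ∀ v, ρ v ≤ ρ' v) (v : V) : assign ρ (S \ {v | r ≤ ρ v}) r v ≤ ρ' v := by
  have hS : S ⊆ {v | r ≤ ρ' v} := by
    refine h.least _ ⟨fun v hv => le_trans hv (hle v), fun v hodd hr hv => ?_, fun v hr hv => ?_⟩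
    · refine hρ' v r hr (ParityGame.cpre_mono _ (fun w hw => ?_) hv)
      exact (le_incrAt_iff_of_odd hodd hr h0).2 (le_trans hw (hle w))
    · exact hρ' v r hr (ParityGame.cpre_mono _ (fun w hw => le_incrAt hr hw) hv)
  by_cases hv : v ∈ S \ {v | r ≤ ρ v}
  · rw [assign_of_mem hv]
    exact hS hv.1
  · rw [assign_of_notMem hv]
    exact hle v

/-- All vertices of `S` already had rank at least `f`, so raising them to `r` changes no set `S_q`
with `q ≤ f`. -/
theorem IsFallback.le_assign_iff {ρ : V → Rank m} {S : Set V} {r f : Rank m}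
    (hf : IsFallback ρ S r f) {q : Rank m} (hq : q ≤ f) (v : V) :
    q ≤ assign ρ (S \ {v | r ≤ ρ v}) r v ↔ q ≤ ρ v := by
  by_cases hv : v ∈ S \ {v | r ≤ ρ v}
  · exact iff_of_true ((assign_of_mem hv).symm ▸ hq.trans hf.lt.le) (hq.trans (hf.subset hv.1))
  · rw [assign_of_notMem hv]

theorem le_assign_self_iff {ρ : V → Rank m} {S : Set V} {r : Rank m}
    (hS : {v | r ≤ ρ v} ⊆ S) (v : V) :
    r ≤ assign ρ (S \ {v | r ≤ ρ v}) r v ↔ v ∈ S := by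
  by_cases hv : v ∈ S \ {v | r ≤ ρ v}
  · rw [assign_of_mem hv]
    exact iff_of_true le_rfl hv.1
  · rw [assign_of_notMem hv]
    exact ⟨fun h => hS h, fun h => not_not.1 fun h' => hv ⟨h, h'⟩⟩

/-- The condition at `q` reads only `S_q` and `S_{decr_ℓ(q)}`, and neither has changed. -/
theorem closed_of_le_fallback {ρ : V → Rank m} {S : Set V} {r f : Rank m}
    (hc : ClosedBelow G ρ r) (hf : IsFallback ρ S r f) {v : V} {q : Rank m} (hqf : q ≤ f)
    (hq : q = proj (G.prio v).val q) (hv : v ∈ G.cpre .odd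
      {w | q ≤ incrAt (G.prio v).val (assign ρ (S \ {v | r ≤ ρ v}) r w)}) :
    q ≤ assign ρ (S \ {v | r ≤ ρ v}) r v := by
  rcases (zeroRank_le q).eq_or_lt with rfl | h0
  · exact zeroRank_le _
  refine (hc v q (hqf.trans_lt hf.lt) hq (ParityGame.cpre_mono _ (fun w hw => ?_) hv)).trans
    (le_assign v)
  rcases Nat.even_or_odd (G.prio v).val with hp | hp
  · exact (le_incrAt_iff_of_even hp hq).2
      ((hf.le_assign_iff hqf w).1 ((le_incrAt_iff_of_even hp hq).1 hw))
  · exact (le_incrAt_iff_of_odd hp hq h0).2 ((hf.le_assign_iff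
      ((decrAt_lt hp hq h0).le.trans hqf) w).1 ((le_incrAt_iff_of_odd hp hq h0).1 hw))

/-- At even priorities this is the closure of `S`, which is the new `S_r`. At odd priorities the
rank `decr_ℓ(r)` is at most `decr r`, and the set for it has not changed because the fallback is
`decr r`. -/
theorem IsUpdate.closed_self {ρ : V → Rank m} {S : Set V} {r : Rank m} (h : IsUpdate G ρ r S)
    (h0 : zeroRank m < r) (hf : IsFallback ρ S r (decr r)) {v : V}
    (hr : r = proj (G.prio v).val r) (hv : v ∈ G.cpre .odd
      {w | r ≤ incrAt (G.prio v).val (assign ρ (S \ {v | r ≤ ρ v}) r w)}) :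
    r ≤ assign ρ (S \ {v | r ≤ ρ v}) r v := by
  rw [le_assign_self_iff h.closed.base]
  rcases Nat.even_or_odd (G.prio v).val with hp | hp
  · refine h.closed.step v hr (ParityGame.cpre_mono _ (fun w hw => ?_) hv)
    exact (le_assign_self_iff h.closed.base w).1 ((le_incrAt_iff_of_even hp hr).1 hw)
  · refine h.closed.odd v hp hr (ParityGame.cpre_mono _ (fun w hw => ?_) hv)
    exact (hf.le_assign_iff (le_decr (decrAt_lt hp hr h0)) w).1
      ((le_incrAt_iff_of_odd hp hr h0).1 hw)

/-! ### The potential -/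

section Potential

variable [Fintype V]

/-- The sum of the positions of the ranks of all vertices. -/
noncomputable def indexSum (ρ : V → Rank m) : ℕ := ∑ v, rankIndex (ρ v)

/-- The potential that bounds the running time of the main loop. -/
noncomputable def potential (ρ : V → Rank m) (r : Rank m) : ℕ :=
  2 * (Fintype.card V * rankIndex (⊤ : Rank m) - indexSum ρ) +
    (rankIndex (⊤ : Rank m) - rankIndex r)

theorem indexSum_le (ρ : V → Rank m) :
    indexSum ρ ≤ Fintype.card V * rankIndex (⊤ : Rank m) := by
  have := Finset.sum_le_card_nsmul Finset.univ (fun v => rankIndex (ρ v))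
    (rankIndex (⊤ : Rank m)) fun v _ => rankIndex_strictMono.monotone le_top
  simpa [indexSum] using this

/-- Every raised vertex gains at least one position. If ranks lie between `f` and `r`, maximality of
`f` yields a vertex of rank exactly `f` that jumps to `r` and gains the whole distance. -/
theorem IsFallback.indexSum_assign {ρ : V → Rank m} {S : Set V} {r f : Rank m}
    (hf : IsFallback ρ S r f) :
    indexSum ρ + (S \ {v | r ≤ ρ v}).ncard + (rankIndex r - rankIndex f - 1) ≤
      indexSum (assign ρ (S \ {v | r ≤ ρ v}) r) := by
  classical
  set D := S \ {v | r ≤ ρ v} with hD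
  have hstep : ∀ v ∈ D, rankIndex (ρ v) + 1 ≤ rankIndex (assign ρ D r v) := fun v hv => by
    rw [assign_of_mem hv]
    exact rankIndex_strictMono (not_le.1 hv.2)
  have hcard : D.ncard = ∑ v, if v ∈ D then 1 else 0 := by
    rw [Set.ncard_eq_toFinset_card', Finset.card_eq_sum_ones, ← Finset.sum_filter]
    congr 1
    ext v
    simp
  have hlt : f < ⊤ := hf.lt.trans_le le_top
  have hfr := rankIndex_strictMono hf.lt
  by_cases hr : incr f < r
  · obtain ⟨u, huS, hu⟩ := Set.not_subset.1 (hf.not_subset _ (lt_incr hlt) hr)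
    have hρu : ρ u = f := le_antisymm ((lt_incr_iff hlt).1 (not_le.1 hu)) (hf.subset huS)
    have huD : u ∈ D := ⟨huS, fun h => (hρu ▸ h : r ≤ f).not_gt hf.lt⟩
    have hsum : (∑ v, if v = u then rankIndex r - rankIndex f - 1 else 0) =
        rankIndex r - rankIndex f - 1 := by simp
    rw [hcard, ← hsum, indexSum, indexSum, ← Finset.sum_add_distrib, ← Finset.sum_add_distrib]
    refine Finset.sum_le_sum fun v _ => ?_
    by_cases hvu : v = u
    · subst hvu
      rw [if_pos huD, if_pos rfl, assign_of_mem huD, hρu]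
      omega
    · rw [if_neg hvu]
      split_ifs with hv
      · exact hstep v hv
      · rw [assign_of_notMem hv]
        omega
  · have h1 : rankIndex r ≤ rankIndex f + 1 := by
      rw [← rankIndex_incr hlt]
      exact rankIndex_strictMono.monotone (not_lt.1 hr)
    rw [show rankIndex r - rankIndex f - 1 = 0 by omega, add_zero, hcard, indexSum, indexSum,
      ← Finset.sum_add_distrib]
    refine Finset.sum_le_sum fun v _ => ?_
    split_ifs with hv
    · exact hstep v hv
    · rw [assign_of_notMem hv]
      omega

end Potential

/-! ### The main loop -/

variable (m) in
/-- A bound for the number of basic set operations in an iteration without changes. -/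
def iterationCost : ℕ :=
  (c / 2 + 2) * (reconstructCost m + 2) + c + 2 * coordCount m + 8

/-- The properties of the ranks and of the current rank at the beginning of an iteration. -/
structure LoopInvariant (G : ParityGame V c) (ρ : V → Rank m) (r : Rank m) : Prop where
  pos : zeroRank m < r
  closed : ClosedBelow G ρ r
  least : ∀ μ : V → Rank m, G.IsProgress μ → ∀ v, ρ v ≤ μ v

/-- The body of the main loop. -/
noncomputable def loopBody (m : Fin c → ℕ) : Prog (Data m) (Reg m) :=
  .withData fun d =>
        .block [
          reconstruct m d.r .old,
          .copy .new .old,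
          updateSet m d.r,
          updateRank m,
          storeSet m d.r]

theorem runs_loopBody [Fintype V] {ρ : V → Rank m} {s : State V (Data m) (Reg m)}
    (h : Represents G ρ s) (hi : LoopInvariant G ρ s.data.r) (hd : s.data.done = false) :
    Runs G (loopBody m) s fun s' a b => ∃ (ρ' : V → Rank m) (x : ℕ), Represents G ρ' s' ∧
      a ≤ iterationCost m * x ∧ b ≤ (c / 2 + 1) * x ∧ 0 < x ∧
      (s'.data.done = true ∧ G.IsProgress ρ' ∧
          (∀ ρ'' : V → Rank m, G.IsProgress ρ'' → ∀ v, ρ' v ≤ ρ'' v) ∧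
          x ≤ 2 * potential ρ s.data.r + 1 ∨
        s'.data.done = false ∧ LoopInvariant G ρ' s'.data.r ∧
          x + 2 * potential ρ' s'.data.r ≤ 2 * potential ρ s.data.r) := by
  refine .withData (.seq ((runs_reconstruct (d := .old) _ (fun h => h)
    (by simp [Reg.Scratch]) h).mono ?_))
  rintro s₁ a₁ b₁ ⟨ha₁, rfl, hdata₁, hreg₁, hold₁⟩
  have hr₁ : Represents G ρ s₁ := h.congr fun x hx => hreg₁ x (hx.ne fun h => h) (by
    rintro (rfl | rfl) <;> exact hx)
  refine .seq (.copy fun s₂ h₂ => ?_)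
  have hr₂ : Represents G ρ s₂ := hr₁.stores (d := .new) (fun h => h) h₂
  have hold₂ : s₂.reg .old = {v | s.data.r ≤ ρ v} := by rw [h₂.ne _ (by simp), hold₁]
  have hnew₂ : s₂.reg .new = {v | s.data.r ≤ ρ v} := by rw [h₂.self, hold₁]
  refine .seq ((runs_updateSet hr₂ s.data.r hnew₂).mono ?_)
  rintro s₃ a₃ b₃ ⟨ha₃, hb₃, hdata₃, hreg₃, hupd⟩
  have hr₃ : Represents G ρ s₃ := hr₂.congr fun x hx =>
    hreg₃ x (hx.ne fun h => h) (hx.ne fun h => h) (hx.ne fun h => h) (hx.ne fun h => h) (by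
      rintro (rfl | rfl) <;> exact hx)
  have hold₃ : s₃.reg .old = {v | s.data.r ≤ ρ v} := by
    rw [hreg₃ _ (by simp) (by simp) (by simp) (by simp) (by simp [Reg.Scratch]), hold₂]
  have hd₃ : s₃.data = s.data := by rw [hdata₃, h₂.data, hdata₁]
  rw [hnew₂] at ha₃ hb₃
  set S := s₃.reg .new with hS
  refine .seq ((runs_updateRank hr₃ (by rw [hd₃]; exact hi.pos)).mono ?_)
  rintro s₄ a₄ b₄ ⟨f, hf, rfl, hreg₄, ha₄, hexit, hforward, hback⟩
  rw [hd₃] at hf ha₄ hexit hforward hback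
  have hr₄ : Represents G ρ s₄ := hr₃.congr fun x hx => hreg₄ x (hx.ne fun h => h) (by
    rintro (rfl | rfl) <;> exact hx)
  have hold₄ : s₄.reg .old = {v | s.data.r ≤ ρ v} := by
    rw [hreg₄ _ (by simp) (by simp [Reg.Scratch]), hold₃]
  have hnew₄ : s₄.reg .new = S := hreg₄ _ (by simp) (by simp [Reg.Scratch])
  refine .seq ((runs_storeSet hr₄ hold₄).mono ?_)
  rintro s₅ a₅ b₅ ⟨hr₅, hdata₅, ha₅, rfl⟩
  rw [hold₄, hnew₄] at hr₅
  rw [← hS] at hf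
  clear_value S
  set r := s.data.r with hr
  set ρ' := assign ρ (S \ {v | r ≤ ρ v}) r with hρ'
  have hfr := rankIndex_strictMono hf.lt
  have hsum := hf.indexSum_assign
  rw [← hρ'] at hsum
  have hsum' := indexSum_le ρ'
  have hrtop : rankIndex r ≤ rankIndex (⊤ : Rank m) := rankIndex_strictMono.monotone le_top
  have hleast : ∀ ρ'' : V → Rank m, G.IsProgress ρ'' → ∀ v, ρ' v ≤ ρ'' v := fun ρ'' hρ'' =>
    hupd.le_of_isProgress hi.pos hρ'' (hi.least ρ'' hρ'')
  -- The work of an iteration: the number of raised vertices, which bounds the productive saturation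
  -- rounds, plus the number of ranks inspected on the way down to `f`.
  refine .skip ⟨ρ', (S \ {v | r ≤ ρ v}).ncard + (rankIndex r - rankIndex f), hr₅, ?_, ?_,
    by omega, ?_⟩
  · generalize (S \ {v | r ≤ ρ v}).ncard = D at *
    obtain ⟨e, he⟩ : ∃ e, rankIndex r - rankIndex f = e + 1 :=
      ⟨rankIndex r - rankIndex f - 1, by omega⟩
    rw [he] at ha₄ ⊢
    have h1 : (reconstructCost m + 1) * e ≤ iterationCost m * e :=
      Nat.mul_le_mul_right e (by
        rw [iterationCost]
        nlinarith [Nat.zero_le (c / 2 * (reconstructCost m + 2))])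
    have h2 : 4 * D ≤ iterationCost m * D :=
      Nat.mul_le_mul_right D (by rw [iterationCost]; omega)
    have h3 : iterationCost m = c / 2 * (reconstructCost m + 2) + 2 * (reconstructCost m + 2) + c +
      2 * coordCount m + 8 := by rw [iterationCost]; ring
    calc _ ≤ iterationCost m * D + iterationCost m * e + iterationCost m := by
          rw [Nat.mul_succ] at ha₄
          omega
      _ = _ := by ring
  · generalize (S \ {v | r ≤ ρ v}).ncard = D at *
    obtain ⟨e, he⟩ : ∃ e, rankIndex r - rankIndex f = e + 1 :=
      ⟨rankIndex r - rankIndex f - 1, by omega⟩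
    rw [he]
    nlinarith [Nat.zero_le (c / 2 * D), Nat.zero_le (c / 2 * e)]
  · rw [hdata₅]
    -- If no lower condition is disturbed, `r` is settled and advances or the loop ends. Otherwise
    -- `r` drops by `rankIndex r - rankIndex f - 1` positions and the index sum grows by at least as
    -- much; the weight `2` in the potential leaves enough to pay for the work as well.
    by_cases hfd : f = decr r
    · subst hfd
      have hidx := rankIndex_decr hi.pos
      by_cases htop : r = ⊤
      · refine Or.inl ⟨hexit rfl htop, fun v q hq hv => ?_, hleast, ?_⟩
        · rcases (le_top : q ≤ ⊤).lt_or_eq with hlt | rfl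
          · exact closed_of_le_fallback hi.closed hf (le_decr (htop ▸ hlt)) hq hv
          · rw [← htop] at hq hv ⊢
            exact hupd.closed_self hi.pos hf hq hv
        · rw [potential]
          omega
      · obtain ⟨h1, h2⟩ := hforward rfl htop
        have hlt : r < ⊤ := lt_top_iff_ne_top.2 htop
        refine Or.inr ⟨h1.trans hd, ⟨h2 ▸ hi.pos.trans (lt_incr hlt), fun v q hlt' hq hv => ?_,
          hleast⟩, ?_⟩
        · rw [h2, lt_incr_iff hlt] at hlt'
          rcases hlt'.lt_or_eq with hlt' | rfl
          · exact closed_of_le_fallback hi.closed hf (le_decr hlt') hq hv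
          · exact hupd.closed_self hi.pos hf hq hv
        · have h3 := rankIndex_incr hlt
          have h4 := rankIndex_strictMono hlt
          rw [potential, potential, h2]
          omega
    · obtain ⟨h1, h2⟩ := hback hfd
      have hlt : f < ⊤ := hf.lt.trans_le le_top
      have hfd' : f < decr r := lt_of_le_of_ne (le_decr hf.lt) hfd
      refine Or.inr ⟨h1.trans hd, ⟨h2 ▸ (zeroRank_le f).trans_lt (lt_incr hlt),
        fun v q hlt' hq hv => ?_, hleast⟩, ?_⟩
      · rw [h2, lt_incr_iff hlt] at hlt'
        exact closed_of_le_fallback hi.closed hf hlt' hq hv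
      · have h3 := rankIndex_incr hlt
        have h4 := rankIndex_strictMono hfd'
        have h5 := rankIndex_decr hi.pos
        rw [potential, potential, h2]
        omega

theorem runs_loop [Fintype V] {ρ : V → Rank m} {s : State V (Data m) (Reg m)}
    (h : Represents G ρ s) (hi : LoopInvariant G ρ s.data.r) (hd : s.data.done = false) :
    Runs G (.while (.data fun d => d.done = false) (loopBody m)) s fun s' a b =>
      ∃ ρ' : V → Rank m, Represents G ρ' s' ∧ G.IsProgress ρ' ∧
        (∀ ρ'' : V → Rank m, G.IsProgress ρ'' → ∀ v, ρ' v ≤ ρ'' v) ∧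
        a ≤ iterationCost m * (2 * potential ρ s.data.r + 1) ∧
        b ≤ (c / 2 + 1) * (2 * potential ρ s.data.r + 1) := by
  induction hn : potential ρ s.data.r using Nat.strong_induction_on generalizing ρ s with
  | _ n ih =>
    refine .whileTrue hd (.seq ((runs_loopBody h hi hd).mono ?_))
    rintro s₁ a b ⟨ρ₁, x, h₁, ha, hb, hx, ⟨hd₁, hp, hl, hle⟩ | ⟨hd₁, hi₁, hle⟩⟩
    · refine .whileFalse (fun hc => ?_) ⟨ρ₁, h₁, hp, hl, ?_, ?_⟩
      · change s₁.data.done = false at hc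
        rw [hd₁] at hc
        exact absurd hc (by simp)
      · simp only [Cond.cost, zero_add, add_zero]
        exact ha.trans (Nat.mul_le_mul_left _ (hn ▸ hle))
      · exact hb.trans (Nat.mul_le_mul_left _ (hn ▸ hle))
    · refine (ih _ (by omega) h₁ hi₁ hd₁ rfl).mono ?_
      rintro s' a' b' ⟨ρ', h', hp, hl, ha', hb'⟩
      rw [hn] at hle
      refine ⟨ρ', h', hp, hl, ?_, ?_⟩
      · simp only [Cond.cost, zero_add]
        refine (Nat.add_le_add ha ha').trans ?_
        rw [← Nat.mul_add]
        exact Nat.mul_le_mul_left _ (by omega)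
      · refine (Nat.add_le_add hb hb').trans ?_
        rw [← Nat.mul_add]
        exact Nat.mul_le_mul_left _ (by omega)

/-- The only rank in question is `0̄`, whose condition is trivial. -/
theorem closedBelow_incr_zeroRank (G : ParityGame V c) (ρ : V → Rank m) :
    ClosedBelow G ρ (incr (zeroRank m)) := by
  intro v q hq _ _
  rw [lt_incr_iff zeroRank_lt_top] at hq
  exact hq.trans (zeroRank_le _)

/-- The algorithm computes the least progress measure. -/
theorem runs_symbolicParityDominion [Fintype V] {s : State V (Data m) (Reg m)}
    (h : HoldsInput m G s) : Runs G (symbolicParityDominion m) s fun s' a b =>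
      ∃ ρ : V → Rank m, G.IsProgress ρ ∧
        (∀ ρ' : V → Rank m, G.IsProgress ρ' → ∀ v, ρ v ≤ ρ' v) ∧
        s'.reg .top = {v | ρ v = ⊤} ∧ s'.reg .result = {v | ρ v = ⊤}ᶜ ∧
        a ≤ 2 + coordCount m +
          iterationCost m * (2 * ((2 * Fintype.card V + 1) * rankIndex (⊤ : Rank m)) + 1) ∧
        b ≤ (c / 2 + 1) * (2 * ((2 * Fintype.card V + 1) * rankIndex (⊤ : Rank m)) + 1) := by
  refine .seq ((runs_initialise h).mono ?_)
  rintro s₁ a₁ b₁ ⟨hr₁, ha₁, rfl⟩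
  refine .seq (.modify fun s₂ hdata₂ hreg₂ => .seq ((runs_loop (ρ := fun _ => zeroRank m)
    (hr₁.congr fun x _ => by rw [hreg₂]) ⟨?_, ?_, fun _ _ _ => zeroRank_le _⟩ ?_).mono ?_))
  · rw [hdata₂]
    exact lt_incr zeroRank_lt_top
  · rw [hdata₂]
    exact closedBelow_incr_zeroRank G _
  · rw [hdata₂]
  rintro s₃ a₃ b₃ ⟨ρ, hr, hp, hl, ha, hb⟩
  have hpot : potential (fun _ : V => zeroRank m) s₂.data.r ≤
      (2 * Fintype.card V + 1) * rankIndex (⊤ : Rank m) := by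
    rw [potential, Nat.add_mul, mul_assoc, one_mul]
    omega
  refine .seq (.setOp fun s₄ h₄ => .skip ⟨ρ, hp, hl, ?_, ?_, ?_, ?_⟩)
  · rw [h₄.ne _ (by simp), hr.top]
  · rw [h₄.self, hr.top, hr.all, SetOp.eval, Set.compl_eq_univ_sdiff]
  · have := ha.trans (Nat.mul_le_mul_left (iterationCost m)
      (Nat.add_le_add_right (Nat.mul_le_mul_left 2 hpot) 1))
    omega
  · have := hb.trans (Nat.mul_le_mul_left (c / 2 + 1)
      (Nat.add_le_add_right (Nat.mul_le_mul_left 2 hpot) 1))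
    omega

end MainLoop

/-! ## Counting -/

section Counting

variable {V : Type*} [Fintype V] {c : ℕ} (G : ParityGame V c)

theorem sum_classSize : ∑ i, G.classSize i = Fintype.card V := by
  classical
  rw [← Finset.card_univ, Finset.card_eq_sum_card_fiberwise (f := G.prio) (t := Finset.univ)
    fun _ _ => Finset.mem_coe.2 (Finset.mem_univ _)]
  refine Finset.sum_congr rfl fun i _ => ?_
  rw [ParityGame.classSize, Set.ncard_eq_toFinset_card']
  congr 1
  ext v
  rw [Set.mem_toFinset, Finset.mem_filter]
  exact (and_iff_right (Finset.mem_univ v)).symm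

variable {G}

theorem one_le_classSize (hG : ∀ i : Fin c, 0 < i.val → (G.prioSet i).Nonempty) (i : Fin c) :
    1 ≤ G.classSize i + if i.val = 0 then 1 else 0 := by
  split_ifs with hi
  · omega
  · have : 0 < G.classSize i := (hG i (by omega)).ncard_pos
    omega

theorem sum_ite_val_eq_zero_le (k : ℕ) : (∑ i : Fin k, if i.val = 0 then 1 else 0) ≤ 1 := by
  rw [← Finset.card_filter, Finset.card_le_one]
  intro i hi j hj
  rw [Finset.mem_filter] at hi hj
  exact Fin.ext (hi.2.trans hj.2.symm)

/-- The classes are disjoint and only `P_0` may be empty, which accounts for the `+ 1`. -/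
theorem le_card_add_one (hG : ∀ i : Fin c, 0 < i.val → (G.prioSet i).Nonempty) :
    c ≤ Fintype.card V + 1 := by
  have h := Finset.sum_le_sum fun i (_ : i ∈ Finset.univ) => one_le_classSize hG i
  rw [Finset.sum_add_distrib, sum_classSize] at h
  have := sum_ite_val_eq_zero_le c
  simp only [Finset.sum_const, Finset.card_univ, Fintype.card_fin, smul_eq_mul, mul_one] at h
  omega

/-- The even priority `2 k`. -/
def evenPrio {c : ℕ} (k : Fin (c / 2)) : Fin c := ⟨2 * k.val, by omega⟩

theorem sum_odd_add_sum_even_le :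
    ∑ k : Fin (c / 2), G.classSize (oddPrio k) + ∑ k : Fin (c / 2), G.classSize (evenPrio k) ≤
      Fintype.card V := by
  let e : Fin (c / 2) ⊕ Fin (c / 2) → Fin c := Sum.elim oddPrio evenPrio
  have he : Function.Injective e := by
    rintro (j | j) (k | k) h <;> have h' := congrArg Fin.val h <;>
      simp only [e, Sum.elim_inl, Sum.elim_inr, oddPrio, evenPrio] at h'
    · exact congrArg _ (Fin.ext (by omega))
    · omega
    · omega
    · exact congrArg _ (Fin.ext (by omega))
  have h := Finset.sum_le_sum_of_subset (f := G.classSize)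
    (Finset.subset_univ (Finset.univ.map ⟨e, he⟩))
  rw [sum_classSize, Finset.sum_map, Fintype.sum_sum_type] at h
  exact h

/-- The extra `1` of each odd priority is charged to the even priority just below it; only `P_0` may
fail to pay. -/
theorem coordCount_le (hG : ∀ i : Fin c, 0 < i.val → (G.prioSet i).Nonempty) :
    coordCount G.classSize ≤ Fintype.card V + 1 := by
  have h := Finset.sum_le_sum fun (k : Fin (c / 2)) (_ : k ∈ Finset.univ) =>
    one_le_classSize hG (evenPrio k)
  have h' : ∀ k : Fin (c / 2), (evenPrio k).val = 0 ↔ k.val = 0 := fun k => by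
    simp [evenPrio]
  simp only [h'] at h
  rw [Finset.sum_add_distrib] at h
  simp only [Finset.sum_const, Finset.card_univ, Fintype.card_fin, smul_eq_mul, mul_one] at h
  have h1 := sum_ite_val_eq_zero_le (c / 2)
  have h2 := sum_odd_add_sum_even_le (G := G)
  have h3 : coordCount G.classSize = ∑ k : Fin (c / 2), G.classSize (oddPrio k) + c / 2 := by
    simp [coordCount, coordMax, odd_oddPrio, Finset.sum_add_distrib]
  omega

theorem prod_le_pow_div_card {ι : Type*} [Fintype ι] [Nonempty ι] (f : ι → ℝ)
    (hf : ∀ i, 0 ≤ f i) : ∏ i, f i ≤ ((∑ i, f i) / Fintype.card ι) ^ Fintype.card ι := by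
  have hk : (Fintype.card ι : ℝ) ≠ 0 := by exact_mod_cast Fintype.card_ne_zero
  have h := Real.geom_mean_le_arith_mean_weighted Finset.univ
    (fun _ : ι => ((Fintype.card ι : ℝ))⁻¹) f (fun _ _ => by positivity) (by simp [hk])
    fun i _ => hf i
  rw [Real.finsetProd_rpow _ _ fun i _ => hf i, ← Finset.mul_sum] at h
  have hp : 0 ≤ ∏ i, f i := Finset.prod_nonneg fun i _ => hf i
  have h' := pow_le_pow_left₀ (Real.rpow_nonneg hp _) h (Fintype.card ι)
  rwa [Real.rpow_inv_natCast_pow hp Fintype.card_ne_zero, mul_comm, ← div_eq_mul_inv] at h'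

/-- Even coordinates have the single value `0` and contribute the factor `1`. -/
theorem rankIndex_top_eq {m : Fin c → ℕ} :
    rankIndex (⊤ : Rank m) = ∏ k : Fin (c / 2), (coordMax m (oddPrio k) + 1) := by
  rw [rankIndex_top]
  refine (Fintype.prod_of_injective oddPrio oddPrio_injective _ _ (fun i hi => ?_)
    fun _ => rfl).symm
  have hodd : ¬ Odd i.val := fun h => hi (by
    obtain ⟨k, rfl⟩ := eq_oddPrio_of_odd h
    exact ⟨k, rfl⟩)
  simp [coordMax, hodd]

theorem rankIndex_top_le [Nonempty V]
    (hG : ∀ i : Fin c, 0 < i.val → (G.prioSet i).Nonempty) :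
    (rankIndex (⊤ : Rank G.classSize) : ℝ) ≤ 3 * xi (Fintype.card V) c := by
  have hc := le_card_add_one hG
  have hn : 0 < Fintype.card V := Fintype.card_pos
  have hn' : (0 : ℝ) < Fintype.card V := by exact_mod_cast hn
  rw [rankIndex_top_eq, xi]
  rcases Nat.eq_zero_or_pos (c / 2) with h0 | h0
  · have : IsEmpty (Fin (c / 2)) := by rw [h0]; infer_instance
    simp [h0]
  · have : Nonempty (Fin (c / 2)) := ⟨⟨0, h0⟩⟩
    have hk : (0 : ℝ) < (c / 2 : ℕ) := by exact_mod_cast h0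
    have h1 := prod_le_pow_div_card
      (fun k : Fin (c / 2) => ((coordMax G.classSize (oddPrio k) + 1 : ℕ) : ℝ))
      fun _ => Nat.cast_nonneg _
    rw [Fintype.card_fin, ← Nat.cast_sum, ← Nat.cast_prod] at h1
    have h2 : ((coordCount G.classSize : ℕ) : ℝ) ≤ Fintype.card V + 1 := by
      exact_mod_cast coordCount_le hG
    -- The cost of having the sum `n + 1` instead of `n` in the bound by the arithmetic mean: a
    -- factor of at most `e`, since there are at most `n` factors.
    have h3 : (1 + 1 / (Fintype.card V : ℝ)) ^ (c / 2) ≤ 3 := by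
      calc (1 + 1 / (Fintype.card V : ℝ)) ^ (c / 2)
          ≤ Real.exp (1 / Fintype.card V) ^ (c / 2) := by
            refine pow_le_pow_left₀ (by positivity) ?_ _
            rw [add_comm]
            exact Real.add_one_le_exp _
        _ = Real.exp ((c / 2 : ℕ) * (1 / Fintype.card V)) := (Real.exp_nat_mul _ _).symm
        _ ≤ Real.exp 1 := by
            refine Real.exp_le_exp.2 ?_
            rw [mul_one_div, div_le_one hn']
            exact_mod_cast (by omega : c / 2 ≤ Fintype.card V)
        _ ≤ 3 := Real.exp_one_lt_three.le
    refine h1.trans ?_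
    calc _ ≤ ((Fintype.card V + 1 : ℝ) / (c / 2 : ℕ)) ^ (c / 2) := by
          refine pow_le_pow_left₀ (by positivity) ?_ _
          exact div_le_div_of_nonneg_right h2 hk.le
      _ = (1 + 1 / (Fintype.card V : ℝ)) ^ (c / 2) *
            ((Fintype.card V : ℝ) / (c / 2 : ℕ)) ^ (c / 2) := by
          rw [← mul_pow]
          congr 1
          field_simp
      _ ≤ _ := mul_le_mul_of_nonneg_right h3 (by positivity)

theorem card_reg_le (m : Fin c → ℕ) : Fintype.card (Reg m) ≤ 10 + c + coordCount m := by
  let f : (Fin 10 ⊕ Fin c) ⊕ ((k : Fin (c / 2)) × Fin (coordMax m (oddPrio k) + 1)) → Reg m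
    | .inl (.inl i) => ![.all, .top, .old, .new, .prev, .excluded, .work, .acc, .aux, .result] i
    | .inl (.inr i) => .prio i
    | .inr ⟨k, x⟩ => .coord k x
  have hf : Function.Surjective f := by
    intro y
    cases y with
    | all => exact ⟨.inl (.inl 0), rfl⟩
    | prio i => exact ⟨.inl (.inr i), rfl⟩
    | coord k x => exact ⟨.inr ⟨k, x⟩, rfl⟩
    | top => exact ⟨.inl (.inl 1), rfl⟩
    | old => exact ⟨.inl (.inl 2), rfl⟩
    | new => exact ⟨.inl (.inl 3), rfl⟩
    | prev => exact ⟨.inl (.inl 4), rfl⟩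
    | excluded => exact ⟨.inl (.inl 5), rfl⟩
    | work => exact ⟨.inl (.inl 6), rfl⟩
    | acc => exact ⟨.inl (.inl 7), rfl⟩
    | aux => exact ⟨.inl (.inl 8), rfl⟩
    | result => exact ⟨.inl (.inl 9), rfl⟩
  refine (Fintype.card_le_of_surjective f hf).trans (le_of_eq ?_)
  simp [coordCount]

theorem step_operations_le {n T : ℕ} (hc : 1 ≤ c) (hn : 1 ≤ n) (hT : 1 ≤ T) :
    (c / 2 + 1) * (2 * ((2 * n + 1) * T) + 1) ≤ 14 * (c * n * T) := by
  have h1 : c / 2 + 1 ≤ 2 * c := by omega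
  have h2 : 2 * ((2 * n + 1) * T) + 1 ≤ 7 * (n * T) := by nlinarith [Nat.mul_le_mul hn hT]
  calc _ ≤ 2 * c * (7 * (n * T)) := Nat.mul_le_mul h1 h2
    _ = _ := by ring

/-- An iteration unit costs at most `3c · 13n + 13 c n = 52 c n`, there are at most `7 n T` units,
and initialisation and output fit into `4 c n² T`; so `368 = 52 · 7 + 4`. -/
theorem set_operations_le {m : Fin c → ℕ} {n T : ℕ} (hc : 1 ≤ c) (hn : 1 ≤ n) (hT : 1 ≤ T)
    (hw : coordCount m ≤ n + 1) :
    2 + coordCount m + iterationCost m * (2 * ((2 * n + 1) * T) + 1) ≤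
      368 * (c * n ^ 2 * T) := by
  have h1 : c / 2 + 2 ≤ 3 * c := by omega
  have h2 : reconstructCost m + 2 ≤ 13 * n := by rw [reconstructCost]; omega
  have h3 : iterationCost m ≤ 52 * (c * n) := by
    rw [iterationCost]
    nlinarith [Nat.mul_le_mul h1 h2, Nat.mul_le_mul hc hn, Nat.mul_le_mul_left c hn,
      Nat.mul_le_mul_right n hc]
  have h4 : 2 * ((2 * n + 1) * T) + 1 ≤ 7 * (n * T) := by nlinarith [Nat.mul_le_mul hn hT]
  have h5 : 2 + coordCount m ≤ 4 * (c * n ^ 2 * T) := by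
    have : n * 1 ≤ c * n ^ 2 * T := by
      refine Nat.mul_le_mul ?_ hT
      nlinarith [Nat.mul_le_mul hc (Nat.mul_le_mul_left n hn)]
    omega
  calc _ ≤ 4 * (c * n ^ 2 * T) + 52 * (c * n) * (7 * (n * T)) :=
        Nat.add_le_add h5 (Nat.mul_le_mul h3 h4)
    _ = _ := by ring

end Counting

end SymbolicParity

/-! ### The main theorem -/

theorem mainTheorem1 :
    ∃ K : ℕ, ∀ (V : Type*) [Fintype V] [Nonempty V] (c : ℕ)
      (G : SymbolicParity.ParityGame V c),
      (∀ i : Fin c, 0 < i.val → (G.prioSet i).Nonempty) →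
      Fintype.card (SymbolicParity.Reg G.classSize) ≤ K * Fintype.card V ∧
      ∀ s : SymbolicParity.State V (SymbolicParity.Data G.classSize)
          (SymbolicParity.Reg G.classSize),
        SymbolicParity.HoldsInput G.classSize G s →
        (∃ s' a b, SymbolicParity.Exec G
          (SymbolicParity.symbolicParityDominion G.classSize) s s' a b) ∧
        ∀ s' a b, SymbolicParity.Exec G
            (SymbolicParity.symbolicParityDominion G.classSize) s s' a b →
          s'.reg .result = G.winEven ∧
          s'.reg .top = G.winOdd ∧
          (b : ℝ) ≤ K * (c * Fintype.card V * SymbolicParity.xi (Fintype.card V) c) ∧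
          (a : ℝ) ≤ K * (c * (Fintype.card V) ^ 2 *
            SymbolicParity.xi (Fintype.card V) c) := by
  -- Replacing the number of rank vectors by `3 ξ` gives the constants `3 · 368 = 1104` and `3 · 14
  -- = 42`; the number of registers is at most `2 n + 12 ≤ 14 n`.
  refine ⟨1200, fun V _ _ c G hG => ?_⟩
  have hn : 1 ≤ Fintype.card V := Fintype.card_pos
  have hcard := SymbolicParity.le_card_add_one hG
  have hcount := SymbolicParity.coordCount_le hG
  have hreg := SymbolicParity.card_reg_le G.classSize
  refine ⟨by omega, fun s hs => ?_⟩
  obtain ⟨s₁, a₁, b₁, hex, ρ, hρ, hmin, htop, hres, ha, hb⟩ :=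
    SymbolicParity.runs_symbolicParityDominion hs
  refine ⟨⟨s₁, a₁, b₁, hex⟩, fun s' a b hex' => ?_⟩
  -- Determinism transfers the result and the bounds from the constructed execution to every
  -- execution.
  obtain ⟨rfl, rfl, rfl⟩ := hex.deterministic hex'
  obtain ⟨hodd, heven⟩ := hρ.winning_sets hmin
  have hc : 1 ≤ c := by
    obtain ⟨v⟩ := ‹Nonempty V›
    have := (G.prio v).isLt
    omega
  have hT : 1 ≤ SymbolicParity.rankIndex (⊤ : SymbolicParity.Rank G.classSize) := by
    have := SymbolicParity.rankIndex_strictMono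
      (SymbolicParity.zeroRank_lt_top (m := G.classSize))
    omega
  have hxi := SymbolicParity.rankIndex_top_le hG
  have hb' := hb.trans (SymbolicParity.step_operations_le hc hn hT)
  have ha' := ha.trans (SymbolicParity.set_operations_le hc hn hT hcount)
  have hxi0 : 0 ≤ SymbolicParity.xi (Fintype.card V) c := by
    rw [SymbolicParity.xi]
    positivity
  refine ⟨hres.trans heven, htop.trans hodd, ?_, ?_⟩
  · have h1 : (b₁ : ℝ) ≤ 14 * (c * Fintype.card V *
        SymbolicParity.rankIndex (⊤ : SymbolicParity.Rank G.classSize)) := by exact_mod_cast hb'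
    have h2 := mul_le_mul_of_nonneg_left hxi
      (by positivity : (0 : ℝ) ≤ c * Fintype.card V)
    have h3 : 0 ≤ (c * Fintype.card V : ℝ) * SymbolicParity.xi (Fintype.card V) c := by positivity
    push_cast
    linarith
  · have h1 : (a₁ : ℝ) ≤ 368 * (c * (Fintype.card V) ^ 2 *
        SymbolicParity.rankIndex (⊤ : SymbolicParity.Rank G.classSize)) := by exact_mod_cast ha'
    have h2 := mul_le_mul_of_nonneg_left hxi
      (by positivity : (0 : ℝ) ≤ c * (Fintype.card V) ^ 2)
    have h3 : 0 ≤ (c * (Fintype.card V) ^ 2 : ℝ) * SymbolicParity.xi (Fintype.card V) c := by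
      positivity
    push_cast
    linarith
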